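/- **Setting.** Let $k\ge 2$. Let $E_1,\dots,E_k$ be finite sets, $|E_i|=2m_i$ with $m_i\ge 2$, each with a fixed-point-free involution $a\mapsto a^{-1}$. For $i\ne j$ put $F(i,j)=E_i\times E_j\times E_i\times E_j$. Let $R\subseteq\bigsqcup_{i\neq j}F(i,j)$ be a set of squares that is compatible with the identifications $F(i,j)\cong F(j,i)$, $(a,b,a',b')\mapsto (b'^{-1},a'^{-1},b^{-1},a^{-1})$, and let $\Gamma$ be the group generated by $E_1\sqcup\dots\sqcup E_k$ with the relations $aba'b'=1$ for $(a,b,a',b')\in R$, where $a^{-1}$ is the inverse of $a$ in $\Gamma$. $\Gamma$ is called a *$k$-cube group* with *adjacency structure* $E_1,\dots,E_k$ if: * **C1.** If $(a,b,a',b')\in R$, then $(a^{-1},b'^{-1},a'^{-1},b^{-1})$, $(a',b',a,b)$ and $(a'^{-1},b^{-1},a^{-1},b'^{-1})$ are in $R$, and the four tuples are distinct. * **C2.** For $i\ne j$, each of the four projections of $R\cap F(i,j)$ onto two cyclically consecutive coordinates is a bijection onto $E_i\times E_j$ or $E_j\times E_i$. * **C3.** Let $p\in\{1,\dots,k\}$,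 let $J\subseteq\{1,\dots,k\}\setminus\{p\}$ be non-empty, and let $(u,v_j,u^j,w_j)\in R\cap F(p,j)$, $j\in J$, be squares with the same first entry $u$. Then there are unique $u^L\in E_p$ for $L\subseteq J$ and $v_i^L,w_i^L\in E_i$ for $L\subseteq J$, $i\in J\setminus L$, with $u^\emptyset=u$, $u^{\{j\}}=u^j$, $v_j^\emptyset=v_j$, $w_j^\emptyset=w_j$ and, for all $L\subseteq J$ and all distinct $i,j\in J\setminus L$ (in (a): all $j\in J\setminus L$), (a) $(u^L,v_j^L,u^{L\cup\{j\}},w_j^L)\in R$; (b) $((v_i^L)^{-1},v_j^L,(w_i^{L\cup\{j\}})^{-1},w_j^{L\cup\{i\}})\in R$; (c) $(w_i^L,(w_j^L)^{-1},v_i^{L\cup\{j\}},(v_j^{L\cup\{i\}})^{-1})\in R$. (For $k=2$, C3 holds automatically.) Fix $p\in\{1,\dots,k\}$. A *pointed $k$-cube* is a system $A=(u^L,v_i^L,w_i^L)$ satisfying (a)–(c) for $J=\{1,\dots,k\}\setminus\{p\}$; the set of all of them is $\mathcal S_k(\Gamma)$. The *adjacency matrices* $M_1,\dots,M_k$ are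 the $\{0,1\}$-matrices indexed by $\mathcal S_k(\Gamma)$ such that, for $A=(u^L,v_i^L,w_i^L)$ and $B=(x^L,y_i^L,z_i^L)$: * $M_p(A,B)=1$ iff, for all $L\subseteq J$, $u^L\ne (x^L)^{-1}$ and, for all $j\in J\setminus L$, $v_j^L=(z_j^L)^{-1}$ if $|L|$ is even and $w_j^L=(y_j^L)^{-1}$ if $|L|$ is odd; * for $i\ne p$, $M_i(A,B)=1$ iff, for all $L\subseteq J\setminus\{i\}$, $(x^L)^{-1}=u^{L\cup\{i\}}$, $v_i^L\ne (y_i^L)^{-1}$, $w_i^L\ne (z_i^L)^{-1}$, and $(y_j^L)^{-1}=w_j^{L\cup\{i\}}$, $(z_j^L)^{-1}=v_j^{L\cup\{i\}}$ for all $j\in J\setminus(L\cup\{i\})$. A *$k$-rank graph* is a countable small category $\Lambda$ with a functor $d:\Lambda\to\mathbb N^k$ such that every morphism $\lambda$ with $d(\lambda)=\mathbf m+\mathbf n$ can be written in a unique way as $\lambda=\nu\mu$ with $d(\mu)=\mathbf m$, $d(\nu)=\mathbf n$. Its vertices are the morphisms of degree $\mathbf 0$. It is *row-finite* (has *no sources*)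 if for all objects $v$ and all $\mathbf n\in\mathbb N^k$ the set of morphisms of degree $\mathbf n$ with range $v$ is finite (non-empty). Let $\mathcal E(\Gamma)$ be the coloured directed graph with vertex set $\mathcal S_k(\Gamma)$ and with exactly one edge of colour $i$ from $A$ to $B$ whenever $M_i(A,B)=1$, $i=1,\dots,k$. Let $\mathcal G(\Gamma)$ be the category of paths in $\mathcal E(\Gamma)$ modulo the congruence which, for $i\ne j$, identifies a path of length two with colours $i,j$ with every path of length two with colours $j,i$ that has the same end points, and let $d$ count the edges of each colour in a path. **Theorem.** For every $k$-cube group $\Gamma$ with adjacency structure $E_1,\dots,E_k$, $(\mathcal G(\Gamma),d)$ is a row-finite $k$-rank graph with no sources. Its vertices are the pointed $k$-cubes: $A\mapsto \mathrm{id}_A$ is a bijection from $\mathcal S_k(\Gamma)$ onto the set of morphisms of degree $\mathbf 0$. Its $1$-skeleton has incidence matrices $M_1,\dots,M_k$: for all $i$ and all $A,B\in\mathcal S_k(\Gamma)$, the number of morphisms from $A$ to $B$ of degree $\mathbf e_i$ is $M_i(A,B)$. -/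

import Mathlib

open CategoryTheory

universe u v w

/-! ### Square presentations and `k`-cube groups -/

/-- The raw data: sets `E₁, …, E_k` with a map `a ↦ a⁻¹` on each of them, and for all `i, j` the
set `R i j` of those elements `(a, b, a', b')` of `F(i, j) = E i × E j × E i × E j` that lie in
the set of relators. -/
structure SquareData (k : ℕ) where
  E : Fin k → Type u
  inv : ∀ {i : Fin k}, E i → E i
  R : ∀ i j : Fin k, Set (E i × E j × E i × E j)

namespace SquareData

variable {k : ℕ} (D : SquareData.{u} k)

/-- The square `S_H = (a⁻¹, b'⁻¹, a'⁻¹, b⁻¹)`. -/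
def reflH {i j : Fin k} (S : D.E i × D.E j × D.E i × D.E j) : D.E i × D.E j × D.E i × D.E j :=
  (D.inv S.1, D.inv S.2.2.2, D.inv S.2.2.1, D.inv S.2.1)

/-- The square `S_R = (a', b', a, b)`. -/
def rotR {i j : Fin k} (S : D.E i × D.E j × D.E i × D.E j) : D.E i × D.E j × D.E i × D.E j :=
  (S.2.2.1, S.2.2.2, S.1, S.2.1)

/-- The square `S_V = (a'⁻¹, b⁻¹, a⁻¹, b'⁻¹)`. -/
def reflV {i j : Fin k} (S : D.E i × D.E j × D.E i × D.E j) : D.E i × D.E j × D.E i × D.E j :=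
  (D.inv S.2.2.1, D.inv S.2.1, D.inv S.1, D.inv S.2.2.2)

/-- The identification `F(i, j) → F(j, i)`, `(a, b, a', b') ↦ (b'⁻¹, a'⁻¹, b⁻¹, a⁻¹)`. -/
def transpose {i j : Fin k} (S : D.E i × D.E j × D.E i × D.E j) :
    D.E j × D.E i × D.E j × D.E i :=
  (D.inv S.2.2.2, D.inv S.2.2.1, D.inv S.2.1, D.inv S.1)

/-- The defining relators of the group, as words in the free group on `E₁ ⊔ ⋯ ⊔ E_k`: the words
`a b a' b'` for `(a, b, a', b') ∈ R`, and the words `a * (a⁻¹)` which say that the involution is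
the inversion of the group. -/
def relators : Set (FreeGroup (Σ i, D.E i)) :=
  {x | ∃ (i j : Fin k) (S : D.E i × D.E j × D.E i × D.E j), S ∈ D.R i j ∧
      x = FreeGroup.of ⟨i, S.1⟩ * FreeGroup.of ⟨j, S.2.1⟩ *
        FreeGroup.of ⟨i, S.2.2.1⟩ * FreeGroup.of ⟨j, S.2.2.2⟩} ∪
  {x | ∃ (i : Fin k) (a : D.E i), x = FreeGroup.of ⟨i, a⟩ * FreeGroup.of ⟨i, D.inv a⟩}

/-- A system of labels for the edges of an `n`-cube in the direction `p` and the `n - 1`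
directions `j ∈ J`: elements `u^L ∈ E p` for `L ⊆ J`, and `v_i^L, w_i^L ∈ E i` for `L ⊆ J` and
`i ∈ J \ L`. The labels `u`, `v_j`, `u^j`, `w_j` of the initial squares are `u^∅`, `v_j^∅`,
`u^{j}`, `w_j^∅`. -/
@[ext]
structure CubeLabels (p : Fin k) (J : Finset (Fin k)) where
  u : Finset J → D.E p
  v : ∀ (L : Finset J) (i : J), i ∉ L → D.E i
  w : ∀ (L : Finset J) (i : J), i ∉ L → D.E i

variable {D}

theorem not_mem_insert_of_ne {J : Finset (Fin k)} {L : Finset J} {i j : J} (hij : i ≠ j)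
    (hi : i ∉ L) : i ∉ insert j L := by
  simp [hij, hi]

/-- The labels form a cube, that is, all its squares lie in `R`. -/
structure CubeLabels.IsCube {p : Fin k} {J : Finset (Fin k)} (c : D.CubeLabels p J) : Prop where
  /-- Condition (a). -/
  squares_p : ∀ (L : Finset J) (j : J) (hj : j ∉ L),
    (c.u L, c.v L j hj, c.u (insert j L), c.w L j hj) ∈ D.R p j
  /-- Condition (b). -/
  squares_v : ∀ (L : Finset J) (i j : J) (hij : i ≠ j) (hi : i ∉ L) (hj : j ∉ L),
    (D.inv (c.v L i hi), c.v L j hj, D.inv (c.w (insert j L) i (not_mem_insert_of_ne hij hi)),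
      c.w (insert i L) j (not_mem_insert_of_ne hij.symm hj)) ∈ D.R i j
  /-- Condition (c). -/
  squares_w : ∀ (L : Finset J) (i j : J) (hij : i ≠ j) (hi : i ∉ L) (hj : j ∉ L),
    (c.w L i hi, D.inv (c.w L j hj), c.v (insert j L) i (not_mem_insert_of_ne hij hi),
      D.inv (c.v (insert i L) j (not_mem_insert_of_ne hij.symm hj))) ∈ D.R i j

variable (D)

/-- The conditions on `E₁, …, E_k` and `R` in the definition of a `k`-cube group. -/
structure IsCubeGroupData : Prop where
  /-- `E i` is finite, of even cardinality at least `4`. -/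
  card_E : ∀ i, ∃ m : ℕ, 2 ≤ m ∧ Nat.card (D.E i) = 2 * m
  inv_inv : ∀ (i : Fin k) (a : D.E i), D.inv (D.inv a) = a
  inv_ne : ∀ (i : Fin k) (a : D.E i), D.inv a ≠ a
  /-- Relators lie in the sets `F(i, j)` with `i ≠ j`. -/
  R_diag : ∀ i, D.R i i = ∅
  /-- The relators in `F(i, j)` and `F(j, i)` are identified by transposition. -/
  transpose_mem : ∀ i j (S : D.E i × D.E j × D.E i × D.E j), S ∈ D.R i j →
    D.transpose S ∈ D.R j i
  /-- Condition C1. -/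
  c1_mem : ∀ i j (S : D.E i × D.E j × D.E i × D.E j), S ∈ D.R i j →
    D.reflH S ∈ D.R i j ∧ D.rotR S ∈ D.R i j ∧ D.reflV S ∈ D.R i j
  c1_distinct : ∀ i j (S : D.E i × D.E j × D.E i × D.E j), S ∈ D.R i j →
    [S, D.reflH S, D.rotR S, D.reflV S].Nodup
  /-- Condition C2: the projections of `R` onto two cyclically consecutive coordinates are
  bijective. -/
  c2_12 : ∀ i j, i ≠ j → ∀ (a : D.E i) (b : D.E j),
    ∃! S : D.E i × D.E j × D.E i × D.E j, S ∈ D.R i j ∧ S.1 = a ∧ S.2.1 = b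
  c2_23 : ∀ i j, i ≠ j → ∀ (b : D.E j) (a : D.E i),
    ∃! S : D.E i × D.E j × D.E i × D.E j, S ∈ D.R i j ∧ S.2.1 = b ∧ S.2.2.1 = a
  c2_34 : ∀ i j, i ≠ j → ∀ (a : D.E i) (b : D.E j),
    ∃! S : D.E i × D.E j × D.E i × D.E j, S ∈ D.R i j ∧ S.2.2.1 = a ∧ S.2.2.2 = b
  c2_41 : ∀ i j, i ≠ j → ∀ (b : D.E j) (a : D.E i),
    ∃! S : D.E i × D.E j × D.E i × D.E j, S ∈ D.R i j ∧ S.2.2.2 = b ∧ S.1 = a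
  /-- Condition C3: squares `(u, v_j, u^j, w_j) ∈ R ∩ F(p, j)`, `j ∈ J`, with a common first edge
  extend uniquely to a cube. (For `|J| = 1`, hence for `k = 2`, this holds automatically.) -/
  c3 : ∀ (p : Fin k) (J : Finset (Fin k)), p ∉ J → J.Nonempty →
    ∀ (a : D.E p) (b : ∀ j : J, D.E j) (a' : J → D.E p) (b' : ∀ j : J, D.E j),
      (∀ j : J, (a, b j, a' j, b' j) ∈ D.R p j) →
      ∃! c : D.CubeLabels p J, c.IsCube ∧ c.u ∅ = a ∧
        ∀ j : J, c.v ∅ j (Finset.notMem_empty j) = b j ∧ c.u {j} = a' j ∧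
          c.w ∅ j (Finset.notMem_empty j) = b' j

end SquareData

/-- A structure of `k`-cube group on `Γ`: an adjacency structure `E₁, …, E_k` with a set `R` of
squares satisfying the conditions of a `k`-cube group, and an identification of `Γ` with the
group presented by them. -/
structure CubeGroupStructure (k : ℕ) (Γ : Type v) [Group Γ] where
  data : SquareData.{u} k
  isCubeGroupData : data.IsCubeGroupData
  presentation : PresentedGroup data.relators ≃* Γ

/-! ### Pointed cubes, adjacency matrices -/

namespace SquareData

variable {k : ℕ} (D : SquareData.{u} k) (p : Fin k)

/-- The set `𝒮_k` of pointed `k`-cubes `□(u, v_j, u^j, w_j)`, where `j` runs through the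
directions other than the chosen one `p`. -/
def PointedCube : Type u := {c : D.CubeLabels p {p}ᶜ // c.IsCube}

variable {D p}

namespace PointedCube

/-- `B` is adjacent to `A` in the direction `p`: the side of `A` at the end of its edge `u` is the
side of `B` at the origin, and `B` does not backtrack. As the orientation of the labelled edges at
the corner `L` of a cube alternates with the parity of `|L|`, that side of `A` carries the labels
`v^L` with `|L|` even and `w^L` with `|L|` odd. -/
structure AdjP (A B : D.PointedCube p) : Prop where
  even_eq : ∀ L j (hj : j ∉ L), Even L.card → A.1.v L j hj = D.inv (B.1.w L j hj)
  odd_eq : ∀ L j (hj : j ∉ L), Odd L.card → A.1.w L j hj = D.inv (B.1.v L j hj)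
  u_ne : ∀ L, A.1.u L ≠ D.inv (B.1.u L)

/-- `B` is adjacent to `A` in the direction `i ≠ p`. -/
structure AdjNe (i : ({p}ᶜ : Finset (Fin k))) (A B : D.PointedCube p) : Prop where
  u_eq : ∀ L, i ∉ L → D.inv (B.1.u L) = A.1.u (insert i L)
  v_eq : ∀ L j (_ : i ∉ L) (hj : j ∉ L) (hji : j ≠ i),
    D.inv (B.1.v L j hj) = A.1.w (insert i L) j (not_mem_insert_of_ne hji hj)
  w_eq : ∀ L j (_ : i ∉ L) (hj : j ∉ L) (hji : j ≠ i),
    D.inv (B.1.w L j hj) = A.1.v (insert i L) j (not_mem_insert_of_ne hji hj)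
  v_ne : ∀ L (hi : i ∉ L), A.1.v L i hi ≠ D.inv (B.1.v L i hi)
  w_ne : ∀ L (hi : i ∉ L), A.1.w L i hi ≠ D.inv (B.1.w L i hi)

/-- `B` is adjacent to `A` in the `E i` direction. -/
def Adj (i : Fin k) (A B : D.PointedCube p) : Prop :=
  if h : i = p then AdjP A B else AdjNe ⟨i, by simpa using h⟩ A B

end PointedCube

variable (D p)

open Classical in
/-- The adjacency matrices `M₁, …, M_k`. -/
noncomputable def adjMatrix (i : Fin k) : Matrix (D.PointedCube p) (D.PointedCube p) ℕ :=
  fun A B => if PointedCube.Adj i A B then 1 else 0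

end SquareData

/-! ### Higher-rank graphs -/

section HigherRank

variable {k : ℕ} {Λ : Type w} [Category.{v} Λ]

/-- The degree of a morphism with respect to a functor to the monoid `ℕᵏ`, which is regarded as a
category with one object. -/
def degree (d : Λ ⥤ SingleObj (Multiplicative (Fin k → ℕ))) {A B : Λ} (f : A ⟶ B) : Fin k → ℕ :=
  Multiplicative.toAdd (show Multiplicative (Fin k → ℕ) from d.map f)

/-- `(Λ, d)` is a `k`-rank graph: `Λ` is countable and every morphism of degree `m + n` factors
uniquely as a morphism of degree `m` followed by one of degree `n`. -/
structure IsKRankGraph (d : Λ ⥤ SingleObj (Multiplicative (Fin k → ℕ))) : Prop where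
  countable_obj : Countable Λ
  countable_hom : Countable (Σ A B : Λ, A ⟶ B)
  factorization : ∀ {A B : Λ} (f : A ⟶ B) (m n : Fin k → ℕ), degree d f = m + n →
    ∃! x : Σ C : Λ, (A ⟶ C) × (C ⟶ B),
      x.2.1 ≫ x.2.2 = f ∧ degree d x.2.1 = m ∧ degree d x.2.2 = n

/-- The set `Λⁿ(v)` of morphisms of degree `n` with range `v`. -/
def morphismsInto (d : Λ ⥤ SingleObj (Multiplicative (Fin k → ℕ))) (n : Fin k → ℕ) (v : Λ) :
    Set (Σ A : Λ, A ⟶ v) :=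
  {f | degree d f.2 = n}

def IsRowFinite (d : Λ ⥤ SingleObj (Multiplicative (Fin k → ℕ))) : Prop :=
  ∀ n v, (morphismsInto d n v).Finite

def HasNoSources (d : Λ ⥤ SingleObj (Multiplicative (Fin k → ℕ))) : Prop :=
  ∀ n v, (morphismsInto d n v).Nonempty

/-- The set `Λⁿ` of all morphisms of degree `n`; the vertices of `(Λ, d)` are the elements
of `Λ⁰`. -/
def morphismsOfDegree (d : Λ ⥤ SingleObj (Multiplicative (Fin k → ℕ))) (n : Fin k → ℕ) :
    Set (Σ A B : Λ, A ⟶ B) :=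
  {f | degree d f.2.2 = n}

end HigherRank

/-! ### The graph `𝒢(Γ)` -/

namespace SquareData

variable {k : ℕ} (D : SquareData.{u} k) (p : Fin k)

/-- The coloured directed graph on the pointed `k`-cubes, with one edge of colour `i` from `A` to
`B` whenever `M_i(A, B) = 1`. -/
instance skeletonQuiver : Quiver (D.PointedCube p) where
  Hom A B := {i : Fin k // D.adjMatrix p i A B = 1}

/-- Two paths of length two with the same end points are related if they have colours `i`, `j`
and `j`, `i` respectively, where `i ≠ j`. -/
inductive SquareRel : HomRel (Paths (D.PointedCube p))
  | swap {A B C X : D.PointedCube p} (e : A ⟶ B) (f : B ⟶ X) (e' : A ⟶ C) (f' : C ⟶ X)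
      (hne : e.1 ≠ f.1) (h₁ : e'.1 = f.1) (h₂ : f'.1 = e.1) :
      SquareRel ((Paths.of _).map e ≫ (Paths.of _).map f)
        ((Paths.of _).map e' ≫ (Paths.of _).map f')

/-- The category `𝒢(Γ)` of `k`-dimensional paths: paths in the coloured graph, up to the
congruence generated by `SquareRel`. -/
abbrev PathCategory : Type u := CategoryTheory.Quotient (D.SquareRel p)

/-- The vertex of `𝒢(Γ)` given by a pointed cube. -/
def vertex (A : D.PointedCube p) : D.PathCategory p := ⟨A⟩

/-- The edge `e` of colour `i` has degree the `i`-th basis vector. -/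
def colourDegree : D.PointedCube p ⥤q SingleObj (Multiplicative (Fin k → ℕ)) where
  obj _ := SingleObj.star _
  map e := Multiplicative.ofAdd (Pi.single e.1 1)

/-- The degree functor of `𝒢(Γ)`, which counts the edges of each colour of a path. -/
def pathDegree : D.PathCategory p ⥤ SingleObj (Multiplicative (Fin k → ℕ)) :=
  CategoryTheory.Quotient.lift _ (Paths.lift (D.colourDegree p)) (by
    have key : ∀ {A B X : D.PointedCube p} (e : A ⟶ B) (f : B ⟶ X),
        (Paths.lift (D.colourDegree p)).map ((Paths.of _).map e ≫ (Paths.of _).map f) =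
          (Multiplicative.ofAdd (Pi.single e.1 1 + Pi.single f.1 1 : Fin k → ℕ)) := by
      intro A B X e f
      rw [Functor.map_comp, SingleObj.comp_as_mul]
      have h : ∀ {A B : D.PointedCube p} (e : A ⟶ B),
          (Paths.lift (D.colourDegree p)).map ((Paths.of _).map e) =
            (Multiplicative.ofAdd (Pi.single e.1 1 : Fin k → ℕ)) := fun e =>
        Category.id_comp ((D.colourDegree p).map e)
      rw [h, h]
      exact mul_comm (Multiplicative.ofAdd (Pi.single f.1 1 : Fin k → ℕ)) _
    rintro _ _ _ _ ⟨e, f, e', f', hne, h₁, h₂⟩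
    rw [key, key, h₁, h₂, add_comm])

end SquareData

open scoped symmDiff

/-! ### Labellings of the edges of a cube -/

/-! Orient the edges in direction `p` from vertices of even cardinality to odd ones, and all other
edges from odd to even. The labels `u`, `v`, `w` of a pointed cube then sit on oriented edges, and
each relator in (a) reads off a closed walk around a face. Adding the inverse labels for reversed
edges turns a pointed cube into a `Labelling`, where all directions and all vertices play the same
role and the symmetries of C1 are the changes of base vertex of a face. By C2 a labelling is
determined by its labels at one vertex; by C2 and C3 these labels can be prescribed freely.
Adjacency says that the far side of one cube is the near side of the next, without backtracking, and
it too can be tested at a single vertex.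

Hence, in a block of cubes, a missing cube is found by prescribing its labels at the central vertex,
where each label is already known from a neighbour. This gives unique completion of two-coloured
paths to squares (`existsUnique_adj_adj_swap`) and the compatibility of swaps for three colours
(`eq_of_adj_adj_adj`).

These two facts make the path category a `k`-rank graph. Existence of factorizations follows by
swapping edges to the end. For uniqueness, the operation "split off the last edge of colour `i`" is
defined on paths and shown to respect the congruence; the three-colour condition is what this needs.
So the last edge of a colour and the remaining morphism are well defined (`comp_edge_cancel`), and
induction on the total degree concludes. -/

theorem Finset.even_card_symmDiff_singleton {α : Type*} [DecidableEq α] (S : Finset α) (i : α) :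
    Even (S ∆ {i}).card ↔ ¬ Even S.card := by
  by_cases h : i ∈ S
  · have : S ∆ {i} = S.erase i := by ext x; simp [Finset.mem_symmDiff]; grind
    rw [this, ← Finset.card_erase_add_one h, Nat.even_add_one, not_not]
  · have : S ∆ {i} = insert i S := by ext x; simp [Finset.mem_symmDiff]; grind
    rw [this, Finset.card_insert_of_notMem h, Nat.even_add_one]

namespace SquareData

variable {k : ℕ} (D : SquareData.{u} k)

/-- A labelling of the edges of the `k`-cube, whose vertices are the subsets `S` of `Fin k`:
`label i S` is the label of the edge that leaves `S` in the direction `i`. -/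
@[ext]
structure Labelling where
  label : ∀ i, Finset (Fin k) → D.E i
  label_flip : ∀ i S, label i (S ∆ {i}) = D.inv (label i S)
  square : ∀ i j S, i ≠ j →
    (label i S, label j (S ∆ {i}), D.inv (label i (S ∆ {j})), D.inv (label j S)) ∈ D.R i j

variable {D}

namespace Labelling

/-- The labelling moved by the symmetry `S ↦ S ∆ T` of the cube. -/
def translate (X : D.Labelling) (T : Finset (Fin k)) : D.Labelling where
  label i S := X.label i (S ∆ T)
  label_flip i S := by rw [symmDiff_right_comm, X.label_flip]
  square i j S hij := by
    rw [symmDiff_right_comm S {i}, symmDiff_right_comm S {j}]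
    exact X.square i j _ hij

@[simp]
theorem label_translate (X : D.Labelling) (T : Finset (Fin k)) (i : Fin k) (S : Finset (Fin k)) :
    (X.translate T).label i S = X.label i (S ∆ T) := rfl

/-- Crossing an edge in direction `a` inverts the label in that direction. Any other label `j` at
the new vertex lies on the face through the old labels `a` and `j`, which are two consecutive
entries of a square, so C2 determines it. -/
theorem label_symmDiff_eq (hD : D.IsCubeGroupData) {X Y : D.Labelling} {J : Set (Fin k)}
    {S : Finset (Fin k)} (h : ∀ j ∈ J, X.label j S = Y.label j S) {T : Finset (Fin k)}
    (hT : ∀ i ∈ T, i ∈ J) : ∀ j ∈ J, X.label j (S ∆ T) = Y.label j (S ∆ T) := by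
  induction T using Finset.induction_on with
  | empty => rwa [← Finset.bot_eq_empty, symmDiff_bot]
  | insert a T ha ih =>
    have hins : S ∆ insert a T = S ∆ T ∆ {a} := by
      rw [symmDiff_assoc]; congr 1; ext x; simp [Finset.mem_symmDiff]; grind
    rw [hins]
    have ih := ih fun i hi => hT i (Finset.mem_insert_of_mem hi)
    have haJ := hT a (Finset.mem_insert_self a T)
    intro j hj
    by_cases hja : a = j
    · subst hja
      rw [X.label_flip, Y.label_flip, ih a hj]
    · have := (hD.c2_41 a j hja (D.inv (X.label j (S ∆ T))) (X.label a (S ∆ T))).unique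
        ⟨X.square a j _ hja, rfl, rfl⟩
        ⟨Y.square a j _ hja, by simp only [ih j hj], (ih a haJ).symm⟩
      exact congrArg (fun x => x.2.1) this

theorem ext_of_vertex (hD : D.IsCubeGroupData) {X Y : D.Labelling} (S : Finset (Fin k))
    (h : ∀ j, X.label j S = Y.label j S) : X = Y := by
  ext i T
  have := label_symmDiff_eq hD (J := Set.univ) (fun j _ => h j) (T := S ∆ T)
    (fun _ _ => trivial) i trivial
  rwa [symmDiff_symmDiff_cancel_left] at this

/-- `Y` is adjacent to `X` in the direction `i`: the far side of `X` is the near side of `Y`, and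
`Y` does not backtrack. -/
def Adj (i : Fin k) (X Y : D.Labelling) : Prop :=
  ∀ S, i ∈ S → (∀ j ≠ i, X.label j S = Y.label j (S ∆ {i})) ∧ X.label i S ≠ Y.label i (S ∆ {i})

/-- Agreement on the common side spreads from one vertex by `label_symmDiff_eq`. If the cubes
backtracked at some vertex, `X` would be the mirror image `Y.translate {i}` there, hence everywhere,
including at `S`. -/
theorem adj_of_vertex (hD : D.IsCubeGroupData) {i : Fin k} {X Y : D.Labelling}
    (S : Finset (Fin k)) (hi : i ∈ S) (h : ∀ j ≠ i, X.label j S = Y.label j (S ∆ {i}))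
    (hne : X.label i S ≠ Y.label i (S ∆ {i})) : X.Adj i Y := by
  intro T hT
  have key : ∀ j ≠ i, X.label j T = Y.label j (T ∆ {i}) := by
    have := label_symmDiff_eq hD (X := X) (Y := Y.translate {i}) (J := {i}ᶜ) h (T := S ∆ T)
      (by intro j hj; simp only [Finset.mem_symmDiff] at hj; simp; grind)
    rwa [symmDiff_symmDiff_cancel_left] at this
  refine ⟨key, fun heq => hne ?_⟩
  have : X = Y.translate {i} := by
    refine ext_of_vertex hD T fun j => ?_
    by_cases hj : j = i
    · subst hj; exact heq
    · exact key j hj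
  conv_lhs => rw [this]
  rfl

end Labelling

/-! ### Pointed cubes as labellings -/

variable {p : Fin k}

theorem coe_ne_of_compl (j : ({p}ᶜ : Finset (Fin k))) : j.1 ≠ p :=
  fun h => Finset.mem_compl.1 j.2 (Finset.mem_singleton.2 h)

section ofCube

variable (c : D.CubeLabels p {p}ᶜ)

/-- The vertices of a side of the cube, without its coordinate `p`. -/
abbrev projVertex (p : Fin k) (S : Finset (Fin k)) : Finset ({p}ᶜ : Finset (Fin k)) :=
  S.subtype (· ∈ ({p}ᶜ : Finset (Fin k)))

/-- The vertex of even cardinality above `L`. -/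
def evenVertex (L : Finset ({p}ᶜ : Finset (Fin k))) : Finset (Fin k) :=
  if Even L.card then L.map (Function.Embedding.subtype _)
  else insert p (L.map (Function.Embedding.subtype _))

theorem even_card_evenVertex (L : Finset ({p}ᶜ : Finset (Fin k))) :
    Even (evenVertex L).card := by
  unfold evenVertex
  split_ifs with h
  · simpa using h
  · rw [Finset.card_insert_of_notMem (by simp), Nat.even_add_one]
    simpa using h

theorem projVertex_evenVertex (L : Finset ({p}ᶜ : Finset (Fin k))) :
    projVertex p (evenVertex L) = L := by
  ext ⟨x, hx⟩
  have hx' : x ≠ p := by simpa using hx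
  unfold evenVertex
  split_ifs <;> simp [hx']

theorem mem_evenVertex (L : Finset ({p}ᶜ : Finset (Fin k))) (j : ({p}ᶜ : Finset (Fin k))) :
    j.1 ∈ evenVertex L ↔ j ∈ L := by
  conv_rhs => rw [← projVertex_evenVertex L]
  simp

theorem evenVertex_insert {L : Finset ({p}ᶜ : Finset (Fin k))} {j : ({p}ᶜ : Finset (Fin k))}
    (hj : j ∉ L) : evenVertex (insert j L) = evenVertex L ∆ {p} ∆ {j.1} := by
  have hjp := coe_ne_of_compl j
  unfold evenVertex
  simp only [Finset.card_insert_of_notMem hj, Nat.even_add_one]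
  have hj' : j.1 ∉ L.map (Function.Embedding.subtype _) := by simpa using hj
  have hp' : p ∉ L.map (Function.Embedding.subtype _) := by simp
  split_ifs <;> rw [Finset.map_insert] <;> ext x <;>
    simp only [Finset.mem_symmDiff, Finset.mem_insert, Finset.mem_singleton,
      Function.Embedding.subtype_apply] <;> grind

/-- The labels of the edges in the direction `p`. -/
def CubeLabels.labelP (S : Finset (Fin k)) : D.E p :=
  if Even S.card then c.u (projVertex p S) else D.inv (c.u (projVertex p S))

/-- The labels of the edges in a direction other than `p`. -/
def CubeLabels.labelNe (j : ({p}ᶜ : Finset (Fin k))) (S : Finset (Fin k)) : D.E j :=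
  if j.1 ∈ S then
    if Even S.card then D.inv (c.v ((projVertex p S).erase j) j (by simp))
    else c.w ((projVertex p S).erase j) j (by simp)
  else
    if Even S.card then D.inv (c.w ((projVertex p S).erase j) j (by simp))
    else c.v ((projVertex p S).erase j) j (by simp)

/-- The labels of all edges. -/
def CubeLabels.label (i : Fin k) (S : Finset (Fin k)) : D.E i :=
  if h : i = p then h.symm.rec (motive := fun i _ => D.E i) (c.labelP S)
  else c.labelNe ⟨i, by simpa using h⟩ S

theorem CubeLabels.label_self (S : Finset (Fin k)) : c.label p S = c.labelP S := by
  simp [CubeLabels.label]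

theorem CubeLabels.label_ne (j : ({p}ᶜ : Finset (Fin k))) (S : Finset (Fin k)) :
    c.label j S = c.labelNe j S := by
  simp [CubeLabels.label, coe_ne_of_compl j]

/-- The proof of `j ∉ L` among the arguments of `v` prevents rewriting `L` in place. -/
theorem CubeLabels.v_congr {L L' : Finset ({p}ᶜ : Finset (Fin k))} {j : ({p}ᶜ : Finset (Fin k))}
    (h : L = L') (hj : j ∉ L) : c.v L j hj = c.v L' j (h ▸ hj) := by
  subst h; rfl

theorem CubeLabels.w_congr {L L' : Finset ({p}ᶜ : Finset (Fin k))} {j : ({p}ᶜ : Finset (Fin k))}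
    (h : L = L') (hj : j ∉ L) : c.w L j hj = c.w L' j (h ▸ hj) := by
  subst h; rfl

theorem projVertex_symmDiff_self (S : Finset (Fin k)) :
    projVertex p (S ∆ {p}) = projVertex p S := by
  ext ⟨x, hx⟩
  have hx' : x ≠ p := by simpa using hx
  simp [Finset.mem_symmDiff, hx']

theorem projVertex_symmDiff (S : Finset (Fin k)) (j : ({p}ᶜ : Finset (Fin k))) :
    projVertex p (S ∆ {j.1}) = projVertex p S ∆ {j} := by
  ext ⟨x, hx⟩
  simp [Finset.mem_symmDiff, Subtype.ext_iff]

theorem CubeLabels.labelP_even {S : Finset (Fin k)} {L} (hS : Even S.card)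
    (hL : projVertex p S = L) : c.labelP S = c.u L := by
  rw [CubeLabels.labelP, if_pos hS, hL]

theorem CubeLabels.labelP_odd {S : Finset (Fin k)} {L} (hS : ¬ Even S.card)
    (hL : projVertex p S = L) : c.labelP S = D.inv (c.u L) := by
  rw [CubeLabels.labelP, if_neg hS, hL]

theorem CubeLabels.labelNe_mem_even {S : Finset (Fin k)} {L} {j : ({p}ᶜ : Finset (Fin k))}
    (hS : Even S.card) (hj : j ∉ L) (hL : projVertex p S = insert j L) :
    c.labelNe j S = D.inv (c.v L j hj) := by
  have : j.1 ∈ S := by have : j ∈ projVertex p S := by simp [hL]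
                       simpa using this
  rw [CubeLabels.labelNe, if_pos this, if_pos hS,
    c.v_congr (L := (projVertex p S).erase j) (L' := L) (by rw [hL, Finset.erase_insert hj])]

theorem CubeLabels.labelNe_mem_odd {S : Finset (Fin k)} {L} {j : ({p}ᶜ : Finset (Fin k))}
    (hS : ¬ Even S.card) (hj : j ∉ L) (hL : projVertex p S = insert j L) :
    c.labelNe j S = c.w L j hj := by
  have : j.1 ∈ S := by have : j ∈ projVertex p S := by simp [hL]
                       simpa using this
  rw [CubeLabels.labelNe, if_pos this, if_neg hS,
    c.w_congr (L := (projVertex p S).erase j) (L' := L) (by rw [hL, Finset.erase_insert hj])]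

theorem CubeLabels.labelNe_notMem_even {S : Finset (Fin k)} {L} {j : ({p}ᶜ : Finset (Fin k))}
    (hS : Even S.card) (hj : j ∉ L) (hL : projVertex p S = L) :
    c.labelNe j S = D.inv (c.w L j hj) := by
  have : j.1 ∉ S := fun h => hj (by rw [← hL]; simpa using h)
  rw [CubeLabels.labelNe, if_neg this, if_pos hS,
    c.w_congr (L := (projVertex p S).erase j) (L' := L) (by rw [hL, Finset.erase_eq_of_notMem hj])]

theorem CubeLabels.labelNe_notMem_odd {S : Finset (Fin k)} {L} {j : ({p}ᶜ : Finset (Fin k))}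
    (hS : ¬ Even S.card) (hj : j ∉ L) (hL : projVertex p S = L) :
    c.labelNe j S = c.v L j hj := by
  have : j.1 ∉ S := fun h => hj (by rw [← hL]; simpa using h)
  rw [CubeLabels.labelNe, if_neg this, if_neg hS,
    c.v_congr (L := (projVertex p S).erase j) (L' := L) (by rw [hL, Finset.erase_eq_of_notMem hj])]

theorem symmDiff_singleton_of_notMem {α : Type*} [DecidableEq α] {L : Finset α} {j : α}
    (hj : j ∉ L) : L ∆ {j} = insert j L := by
  ext x; simp only [Finset.mem_symmDiff, Finset.mem_singleton, Finset.mem_insert]; grind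

/-- The two ends of an edge have opposite parities, and in each case exactly one of the two labels
is defined as an inverse. -/
theorem CubeLabels.label_flip (hD : D.IsCubeGroupData) (i : Fin k) (S : Finset (Fin k)) :
    c.label i (S ∆ {i}) = D.inv (c.label i S) := by
  have hS := S.even_card_symmDiff_singleton i
  by_cases hi : i = p
  · subst hi
    rw [c.label_self, c.label_self]
    by_cases h : Even S.card
    · rw [c.labelP_even h rfl, c.labelP_odd (by grind) (projVertex_symmDiff_self S)]
    · rw [c.labelP_odd h rfl, c.labelP_even (by grind) (projVertex_symmDiff_self S), hD.inv_inv]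
  · obtain ⟨j, rfl⟩ : ∃ j : ({p}ᶜ : Finset (Fin k)), j.1 = i := ⟨⟨i, by simpa using hi⟩, rfl⟩
    rw [c.label_ne, c.label_ne]
    have hpr := projVertex_symmDiff S j
    by_cases hj : j ∈ projVertex p S
    · have h1 : projVertex p S = insert j ((projVertex p S).erase j) :=
        (Finset.insert_erase hj).symm
      have h2 : projVertex p (S ∆ {j.1}) = (projVertex p S).erase j := by
        rw [hpr]; ext x
        simp only [Finset.mem_symmDiff, Finset.mem_singleton, Finset.mem_erase]; grind
      by_cases h : Even S.card
      · rw [c.labelNe_mem_even h (by simp) h1, c.labelNe_notMem_odd (by grind) (by simp) h2,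
          hD.inv_inv]
      · rw [c.labelNe_mem_odd h (by simp) h1, c.labelNe_notMem_even (by grind) (by simp) h2]
    · rw [symmDiff_singleton_of_notMem hj] at hpr
      by_cases h : Even S.card
      · rw [c.labelNe_notMem_even h hj rfl, c.labelNe_mem_odd (by grind) hj hpr, hD.inv_inv]
      · rw [c.labelNe_notMem_odd h hj rfl, c.labelNe_mem_even (by grind) hj hpr]

end ofCube

/-! ### Faces of the cube lie in `R` -/

/-- The square at the vertex `S` in the directions `i` and `j`. -/
def squareAt (f : ∀ i, Finset (Fin k) → D.E i) (i j : Fin k) (S : Finset (Fin k)) :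
    D.E i × D.E j × D.E i × D.E j :=
  (f i S, f j (S ∆ {i}), D.inv (f i (S ∆ {j})), D.inv (f j S))

/-- Moving the base vertex of a face along direction `i` is the symmetry `reflH` of C1, and
exchanging the two directions is `transpose`. Each face therefore needs checking at one of its four
vertices only. -/
theorem squareAt_of_symmDiff_left (hD : D.IsCubeGroupData) {f : ∀ i, Finset (Fin k) → D.E i}
    (hf : ∀ i S, f i (S ∆ {i}) = D.inv (f i S)) {i j : Fin k} {S : Finset (Fin k)}
    (h : squareAt f i j (S ∆ {i}) ∈ D.R i j) : squareAt f i j S ∈ D.R i j := by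
  have := (hD.c1_mem _ _ _ h).1
  simpa [squareAt, reflH, hf, hD.inv_inv, symmDiff_symmDiff_cancel_right,
    symmDiff_right_comm _ {i} {j}] using this

theorem squareAt_swap (hD : D.IsCubeGroupData) {f : ∀ i, Finset (Fin k) → D.E i} {i j : Fin k}
    {S : Finset (Fin k)} (h : squareAt f i j S ∈ D.R i j) : squareAt f j i S ∈ D.R j i := by
  have := hD.transpose_mem _ _ _ h
  simpa [squareAt, transpose, hD.inv_inv] using this

theorem squareAt_of_symmDiff_right (hD : D.IsCubeGroupData) {f : ∀ i, Finset (Fin k) → D.E i}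
    (hf : ∀ i S, f i (S ∆ {i}) = D.inv (f i S)) {i j : Fin k} {S : Finset (Fin k)}
    (h : squareAt f i j (S ∆ {j}) ∈ D.R i j) : squareAt f i j S ∈ D.R i j :=
  squareAt_swap hD (squareAt_of_symmDiff_left hD hf (squareAt_swap hD h))

namespace CubeLabels

variable {c : D.CubeLabels p {p}ᶜ}

theorem IsCube.squareAt_left (hD : D.IsCubeGroupData) (hc : c.IsCube)
    (j : ({p}ᶜ : Finset (Fin k))) (S : Finset (Fin k)) :
    squareAt c.label p j S ∈ D.R p j := by
  -- Each face has exactly one even vertex without `j`; read from there, it is condition (a).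
  have key : ∀ S : Finset (Fin k), Even S.card → j.1 ∉ S →
      squareAt c.label p j S ∈ D.R p j := by
    intro S hS hj
    have hj' : j ∉ projVertex p S := by simpa using hj
    have h1 := S.even_card_symmDiff_singleton p
    have h2 := S.even_card_symmDiff_singleton j
    have := hc.squares_p (projVertex p S) j hj'
    rwa [squareAt, c.label_self, c.label_self, c.label_ne, c.label_ne, c.labelP_even hS rfl,
      c.labelNe_notMem_odd (by grind) hj' (projVertex_symmDiff_self S),
      c.labelP_odd (by grind)
        ((projVertex_symmDiff S j).trans (symmDiff_singleton_of_notMem hj')),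
      c.labelNe_notMem_even hS hj' rfl, hD.inv_inv, hD.inv_inv]
  have key' : ∀ S : Finset (Fin k), j.1 ∉ S → squareAt c.label p j S ∈ D.R p j := by
    intro S hj
    by_cases hS : Even S.card
    · exact key S hS hj
    · refine squareAt_of_symmDiff_left hD (c.label_flip hD) (key _ ?_ ?_)
      · rwa [Finset.even_card_symmDiff_singleton]
      · simp [Finset.mem_symmDiff, hj, coe_ne_of_compl j]
  by_cases hj : j.1 ∈ S
  · exact squareAt_of_symmDiff_right hD (c.label_flip hD)
      (key' _ (by simp [Finset.mem_symmDiff, hj]))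
  · exact key' S hj

theorem IsCube.squareAt_ne (hD : D.IsCubeGroupData) (hc : c.IsCube)
    {i j : ({p}ᶜ : Finset (Fin k))} (hij : i ≠ j) (S : Finset (Fin k)) :
    squareAt c.label i j S ∈ D.R i j := by
  have hij' : i.1 ≠ j.1 := fun h => hij (Subtype.ext h)
  have key : ∀ S : Finset (Fin k), i.1 ∉ S → j.1 ∉ S →
      squareAt c.label i j S ∈ D.R i j := by
    intro S hi hj
    -- Conditions (b) and (c) start at the vertex `S ∆ {i}`: (c) if `S` is even, (b) if `S` is odd.
    refine squareAt_of_symmDiff_left hD (c.label_flip hD) ?_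
    have hi' : i ∉ projVertex p S := by simpa using hi
    have hj' : j ∉ projVertex p S := by simpa using hj
    have hpi := (projVertex_symmDiff S i).trans (symmDiff_singleton_of_notMem hi')
    have hpj := (projVertex_symmDiff S j).trans (symmDiff_singleton_of_notMem hj')
    have hii := not_mem_insert_of_ne hij hi'
    have hjj := not_mem_insert_of_ne hij.symm hj'
    have hpij : projVertex p (S ∆ {i.1} ∆ {j.1}) = insert i (insert j (projVertex p S)) := by
      rw [projVertex_symmDiff, hpi, symmDiff_singleton_of_notMem hjj, Finset.insert_comm]
    have h1 := S.even_card_symmDiff_singleton i.1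
    have h2 := (S ∆ {i.1}).even_card_symmDiff_singleton j.1
    rw [squareAt, symmDiff_symmDiff_cancel_right, c.label_ne, c.label_ne, c.label_ne, c.label_ne]
    by_cases hS : Even S.card
    · have := hc.squares_w (projVertex p S) i j hij hi' hj'
      rwa [c.labelNe_mem_odd (by grind) hi' hpi, c.labelNe_notMem_even hS hj' rfl,
        c.labelNe_mem_even (by grind) hii hpij, c.labelNe_notMem_odd (by grind) hjj hpi,
        hD.inv_inv]
    · have := hc.squares_v (projVertex p S) i j hij hi' hj'
      rwa [c.labelNe_mem_even (by grind) hi' hpi, c.labelNe_notMem_odd hS hj' rfl,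
        c.labelNe_mem_odd (by grind) hii hpij, c.labelNe_notMem_even (by grind) hjj hpi,
        hD.inv_inv]
  have key' : ∀ S : Finset (Fin k), j.1 ∉ S → squareAt c.label i j S ∈ D.R i j := by
    intro S hj
    by_cases hi : i.1 ∈ S
    · refine squareAt_of_symmDiff_left hD (c.label_flip hD) (key _ ?_ ?_)
      · simp [Finset.mem_symmDiff, hi]
      · simp [Finset.mem_symmDiff, hj, hij'.symm]
    · exact key S hi hj
  by_cases hj : j.1 ∈ S
  · exact squareAt_of_symmDiff_right hD (c.label_flip hD)
      (key' _ (by simp [Finset.mem_symmDiff, hj]))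
  · exact key' S hj

end CubeLabels

namespace PointedCube

/-- The labelling of the edges of a pointed cube. -/
def labelling (hD : D.IsCubeGroupData) (A : D.PointedCube p) : D.Labelling where
  label := A.1.label
  label_flip := A.1.label_flip hD
  square i j S hij := by
    change squareAt A.1.label i j S ∈ D.R i j
    by_cases hi : i = p
    · subst hi
      exact A.2.squareAt_left hD ⟨j, by simpa using hij.symm⟩ S
    · by_cases hj : j = p
      · subst hj
        exact squareAt_swap hD (A.2.squareAt_left hD ⟨i, by simpa using hij⟩ S)
      · exact A.2.squareAt_ne hD (i := ⟨i, by simpa using hi⟩) (j := ⟨j, by simpa using hj⟩)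
          (by simpa using hij) S

variable (hD : D.IsCubeGroupData) (A : D.PointedCube p)

theorem u_eq_label (L : Finset ({p}ᶜ : Finset (Fin k))) :
    A.1.u L = (A.labelling hD).label p (evenVertex L) := by
  change _ = A.1.label p _
  rw [CubeLabels.label_self, CubeLabels.labelP_even _ (even_card_evenVertex L)
    (projVertex_evenVertex L)]

theorem v_eq_label (L : Finset ({p}ᶜ : Finset (Fin k))) (j : ({p}ᶜ : Finset (Fin k)))
    (hj : j ∉ L) : A.1.v L j hj = (A.labelling hD).label j (evenVertex L ∆ {p}) := by
  change _ = A.1.label j _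
  rw [CubeLabels.label_ne, CubeLabels.labelNe_notMem_odd _ _ hj
    ((projVertex_symmDiff_self _).trans (projVertex_evenVertex L))]
  simpa [Finset.even_card_symmDiff_singleton] using even_card_evenVertex L

theorem w_eq_label (L : Finset ({p}ᶜ : Finset (Fin k))) (j : ({p}ᶜ : Finset (Fin k)))
    (hj : j ∉ L) : A.1.w L j hj = (A.labelling hD).label j (evenVertex L ∆ {j.1}) := by
  change _ = A.1.label j _
  rw [CubeLabels.label_ne, CubeLabels.labelNe_mem_odd _ _ hj]
  · rw [projVertex_symmDiff, projVertex_evenVertex, symmDiff_singleton_of_notMem hj]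
  · simpa [Finset.even_card_symmDiff_singleton] using even_card_evenVertex L

theorem labelling_injective : Function.Injective (labelling (p := p) hD) := by
  intro A B h
  refine Subtype.ext (CubeLabels.ext ?_ ?_ ?_)
  · funext L
    rw [A.u_eq_label hD, B.u_eq_label hD, h]
  · funext L j hj
    rw [A.v_eq_label hD, B.v_eq_label hD, h]
  · funext L j hj
    rw [A.w_eq_label hD, B.w_eq_label hD, h]

end PointedCube

/-! ### Cubes with prescribed labels at a vertex -/

/-- The pointed cube of a labelling. -/
def Labelling.toPointedCube (hD : D.IsCubeGroupData) (p : Fin k) (X : D.Labelling) :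
    D.PointedCube p :=
  ⟨{ u := fun L => X.label p (evenVertex L)
     v := fun L j _ => X.label j (evenVertex L ∆ {p})
     w := fun L j _ => X.label j (evenVertex L ∆ {j.1}) },
   { squares_p := by
      intro L j hj
      have := X.square p j (evenVertex L) (coe_ne_of_compl j).symm
      simpa only [evenVertex_insert hj, symmDiff_right_comm _ {p} {j.1}, X.label_flip,
        hD.inv_inv] using this
     squares_v := by
      intro L i j hij hi hj
      have hij' : i.1 ≠ j.1 := fun h => hij (Subtype.ext h)
      have := X.square i j (evenVertex L ∆ {p} ∆ {i.1}) hij'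
      rw [symmDiff_right_comm _ {i.1} {j.1}] at this
      simpa only [evenVertex_insert hj, evenVertex_insert hi, symmDiff_symmDiff_cancel_right,
        X.label_flip, hD.inv_inv] using this
     squares_w := by
      intro L i j hij hi hj
      have hij' : i.1 ≠ j.1 := fun h => hij (Subtype.ext h)
      have := X.square i j (evenVertex L ∆ {i.1}) hij'
      simp only [evenVertex_insert hj, evenVertex_insert hi]
      simpa only [symmDiff_symmDiff_cancel_right, symmDiff_right_comm _ {p}, X.label_flip,
        hD.inv_inv, symmDiff_right_comm _ {i.1} {j.1}] using this }⟩

theorem Labelling.labelling_toPointedCube (hD : D.IsCubeGroupData) (p : Fin k)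
    (X : D.Labelling) : (X.toPointedCube hD p).labelling hD = X := by
  -- At the vertex `{p}` the labels are the inverse of `u^∅` and the `v_j^∅`.
  refine ext_of_vertex hD {p} fun i => ?_
  have hempty : evenVertex (p := p) ∅ = ∅ := by simp [evenVertex]
  have hsing : (∅ : Finset (Fin k)) ∆ {p} = {p} := by rw [← Finset.bot_eq_empty, bot_symmDiff]
  by_cases hi : i = p
  · subst hi
    have := (X.toPointedCube hD i).u_eq_label hD ∅
    rw [hempty] at this
    rw [← hsing, label_flip, label_flip, ← this]
    simp [toPointedCube, hempty]
  · have := (X.toPointedCube hD p).v_eq_label hD ∅ ⟨i, by simpa using hi⟩ (Finset.notMem_empty _)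
    rw [hempty, hsing] at this
    rw [← this]
    simp [toPointedCube, hempty, hsing]

/-- C2 completes each pair of labels to a square and C3 fills in the cube, which gives the labels at
`{p}`; a translation carries them to `S`. The assumption `2 ≤ k` makes the set of directions in C3
non-empty. -/
theorem Labelling.exists_label_eq (hD : D.IsCubeGroupData) (hk : 2 ≤ k) (S : Finset (Fin k))
    (g : ∀ i, D.E i) : ∃ X : D.Labelling, ∀ i, X.label i S = g i := by
  let p : Fin k := ⟨0, by omega⟩
  have hne : (({p}ᶜ : Finset (Fin k))).Nonempty :=
    ⟨⟨1, by omega⟩, by simp [p]⟩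
  -- The edge `u^∅` runs from `∅` to `{p}`, so it must carry the inverse of the label wanted at
  -- `{p}`.
  choose sq hsq _ using fun j : ({p}ᶜ : Finset (Fin k)) =>
    hD.c2_12 p j (coe_ne_of_compl j).symm (D.inv (g p)) (g j)
  obtain ⟨c, ⟨hc, hu, hv⟩, -⟩ := hD.c3 p {p}ᶜ (by simp) hne (D.inv (g p)) (fun j => g j)
    (fun j => (sq j).2.2.1) (fun j => (sq j).2.2.2) (by
      intro j
      obtain ⟨h1, h2, h3⟩ := hsq j
      rw [← h2, ← h3]
      exact h1)
  have hempty : evenVertex (p := p) ∅ = ∅ := by simp [evenVertex]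
  have hsing : (∅ : Finset (Fin k)) ∆ {p} = {p} := by rw [← Finset.bot_eq_empty, bot_symmDiff]
  let A : D.PointedCube p := ⟨c, hc⟩
  refine ⟨(A.labelling hD).translate (S ∆ {p}), fun i => ?_⟩
  rw [label_translate, symmDiff_symmDiff_cancel_left]
  by_cases hi : i = p
  · subst hi
    have := A.u_eq_label hD ∅
    rw [hempty] at this
    rw [← hsing, label_flip, ← this]
    exact (congrArg D.inv hu).trans (hD.inv_inv _ _)
  · have := A.v_eq_label hD ∅ ⟨i, by simpa using hi⟩ (Finset.notMem_empty _)
    rw [hempty, hsing] at this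
    rw [← this]
    exact (hv ⟨i, by simpa using hi⟩).1

/-! ### Completing blocks of adjacent cubes -/

namespace Labelling

variable {i j l : Fin k}

theorem exists_adj_adj_swap (hD : D.IsCubeGroupData) (hk : 2 ≤ k) (hij : i ≠ j)
    {X Y Z : D.Labelling} (hXY : X.Adj i Y) (hYZ : Y.Adj j Z) :
    ∃ W : D.Labelling, X.Adj j W ∧ W.Adj i Z := by
  have h1 : ({i, j} : Finset (Fin k)) ∆ {j} = {i} := by
    ext x; simp only [Finset.mem_symmDiff, Finset.mem_insert, Finset.mem_singleton]; grind
  have h2 : ({i, j} : Finset (Fin k)) ∆ {i} = {j} := by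
    ext x; simp only [Finset.mem_symmDiff, Finset.mem_insert, Finset.mem_singleton]; grind
  have h3 : ∀ i : Fin k, ({i} : Finset (Fin k)) ∆ {i} = ∅ := fun i => symmDiff_self _
  obtain ⟨hX, hX'⟩ := hXY {i, j} (by simp)
  obtain ⟨hY, hY'⟩ := hYZ {j} (by simp)
  simp only [h2, h3] at hX hX' hY hY'
  -- The centre of the `2 × 2` block is the vertex `{i, j}` of `X`, `{j}` of `Y`, `{i}` of `W` and
  -- `∅` of `Z`. There `W` shares its edge in direction `i` with `X` and all others with `Z`.
  obtain ⟨W, hW⟩ := exists_label_eq hD hk {i} (fun m => if m = i then X.label m {i, j}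
    else Z.label m ∅)
  have hWi : W.label i {i} = X.label i {i, j} := by rw [hW, if_pos rfl]
  have hWm : ∀ m ≠ i, W.label m {i} = Z.label m ∅ := fun m hm => by rw [hW, if_neg hm]
  refine ⟨W, adj_of_vertex hD {i, j} (by simp) ?_ ?_, adj_of_vertex hD {i} (by simp) ?_ ?_⟩
  · intro m hm
    rw [h1]
    by_cases hmi : m = i
    · subst hmi; exact hWi.symm
    · rw [hWm m hmi, hX m hmi, hY m hm]
  -- Seen from the centre, this is the non-backtracking of `Y` and `Z`; likewise that of `W` and `Z`
  -- below comes from `X` and `Y`.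
  · rwa [h1, hWm j hij.symm, hX j hij.symm]
  · simpa only [h3] using hWm
  · rwa [h3, hWi, ← hY i hij]

/-- All labels of the missing cube at the centre of the block are forced by `X` and `Z`. -/
theorem eq_of_adj_adj (hD : D.IsCubeGroupData) (hij : i ≠ j) {X W W' Z : D.Labelling}
    (h₁ : X.Adj j W) (h₂ : W.Adj i Z) (h₁' : X.Adj j W') (h₂' : W'.Adj i Z) : W = W' := by
  have h1 : ({i, j} : Finset (Fin k)) ∆ {j} = {i} := by
    ext x; simp only [Finset.mem_symmDiff, Finset.mem_insert, Finset.mem_singleton]; grind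
  refine ext_of_vertex hD {i} fun m => ?_
  by_cases hm : m = i
  · subst hm
    have a := (h₁ {m, j} (by simp)).1 m hij
    have b := (h₁' {m, j} (by simp)).1 m hij
    rw [h1] at a b
    exact a.symm.trans b
  · rw [(h₂ {i} (by simp)).1 m hm, (h₂' {i} (by simp)).1 m hm]

/-- The two ways of filling the side of a `2 × 2 × 2` block of cubes give the same cube. -/
theorem eq_of_adj_adj_adj (hD : D.IsCubeGroupData) (hij : i ≠ j) (hil : i ≠ l) (hjl : j ≠ l)
    {X Y Y' W W' Z : D.Labelling} (hXY : X.Adj j Y) (hYW : Y.Adj l W) (hWZ : W.Adj i Z)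
    (hXY' : X.Adj l Y') (hYW' : Y'.Adj j W') (hWZ' : W'.Adj i Z) : W = W' := by
  have e1 : ({i, j, l} : Finset (Fin k)) ∆ {j} = {i, l} := by
    ext x; simp only [Finset.mem_symmDiff, Finset.mem_insert, Finset.mem_singleton]; grind
  have e2 : ({i, l} : Finset (Fin k)) ∆ {l} = {i} := by
    ext x; simp only [Finset.mem_symmDiff, Finset.mem_insert, Finset.mem_singleton]; grind
  have e3 : ({i, j, l} : Finset (Fin k)) ∆ {l} = {i, j} := by
    ext x; simp only [Finset.mem_symmDiff, Finset.mem_insert, Finset.mem_singleton]; grind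
  have e4 : ({i, j} : Finset (Fin k)) ∆ {j} = {i} := by
    ext x; simp only [Finset.mem_symmDiff, Finset.mem_insert, Finset.mem_singleton]; grind
  -- At the centre of the block, both routes carry the label in direction `i` over from `X`; the
  -- other labels come from `Z`.
  refine ext_of_vertex hD {i} fun m => ?_
  by_cases hm : m = i
  · subst hm
    have a1 := (hXY {m, j, l} (by simp)).1 m hij
    have a2 := (hYW {m, l} (by simp)).1 m hil
    have b1 := (hXY' {m, j, l} (by simp)).1 m hil
    have b2 := (hYW' {m, j} (by simp)).1 m hij
    rw [e1] at a1
    rw [e2] at a2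
    rw [e3] at b1
    rw [e4] at b2
    rw [← a2, ← a1, b1, b2]
  · rw [(hWZ {i} (by simp)).1 m hm, (hWZ' {i} (by simp)).1 m hm]

theorem exists_adj (hD : D.IsCubeGroupData) (hk : 2 ≤ k) (i : Fin k) (Y : D.Labelling) :
    ∃ X : D.Labelling, X.Adj i Y := by
  have h3 : ({i} : Finset (Fin k)) ∆ {i} = ∅ := symmDiff_self _
  -- The inverse label in direction `i` avoids backtracking because the involution has no fixed
  -- points.
  obtain ⟨X, hX⟩ := exists_label_eq hD hk {i} (fun m => if m = i then D.inv (Y.label m ∅)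
    else Y.label m ∅)
  refine ⟨X, adj_of_vertex hD {i} (by simp) (fun m hm => ?_) ?_⟩
  · rw [hX, h3, if_neg hm]
  · rw [hX, h3, if_pos rfl]
    exact hD.inv_ne i _

end Labelling

/-! ### Adjacency of pointed cubes -/

namespace PointedCube

theorem labelling_surjective (hD : D.IsCubeGroupData) :
    Function.Surjective (labelling (p := p) hD) :=
  fun X => ⟨X.toPointedCube hD p, X.labelling_toPointedCube hD p⟩

/-- Forwards, the conditions for `L = ∅` are read at the vertex `{p}`, and `adj_of_vertex` spreads
them. Backwards, the vertices containing `p` form the far side, which contains the edges `v^L` for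
`|L|` even and `w^L` for `|L|` odd. -/
theorem adjP_iff (hD : D.IsCubeGroupData) {A B : D.PointedCube p} :
    AdjP A B ↔ (A.labelling hD).Adj p (B.labelling hD) := by
  constructor
  · intro h
    have hempty : evenVertex (p := p) ∅ = ∅ := by simp [evenVertex]
    have hsing : ∀ i : Fin k, (∅ : Finset (Fin k)) ∆ {i} = {i} := fun i => by
      rw [← Finset.bot_eq_empty, bot_symmDiff]
    have hself : ∀ i : Fin k, ({i} : Finset (Fin k)) ∆ {i} = ∅ := fun i => symmDiff_self _
    refine Labelling.adj_of_vertex hD {p} (by simp) ?_ ?_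
    · intro j hj
      obtain ⟨j, rfl⟩ : ∃ j' : ({p}ᶜ : Finset (Fin k)), j'.1 = j := ⟨⟨j, by simpa using hj⟩, rfl⟩
      have := h.even_eq ∅ j (Finset.notMem_empty _) (by simp)
      rwa [A.v_eq_label hD, B.w_eq_label hD, hempty, hsing, ← Labelling.label_flip, hsing,
        hself, ← hself p] at this
    · have := h.u_ne ∅
      rw [A.u_eq_label hD, B.u_eq_label hD, hempty] at this
      intro heq
      rw [hself, ← hsing, Labelling.label_flip] at heq
      exact this (by rw [← heq, hD.inv_inv])
  · intro h
    refine ⟨fun L j hj hL => ?_, fun L j hj hL => ?_, fun L => ?_⟩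
    · have hp : p ∉ evenVertex L := by simp [evenVertex, hL]
      rw [A.v_eq_label hD, B.w_eq_label hD, Labelling.label_flip, hD.inv_inv,
        (h (evenVertex L ∆ {p}) (by simp [Finset.mem_symmDiff, hp])).1 j (coe_ne_of_compl j),
        symmDiff_symmDiff_cancel_right]
    · have hp : p ∈ evenVertex L := by simp [evenVertex, Nat.not_even_iff_odd.2 hL]
      rw [A.w_eq_label hD, B.v_eq_label hD, Labelling.label_flip,
        (h (evenVertex L) hp).1 j (coe_ne_of_compl j)]
    · rw [A.u_eq_label hD, B.u_eq_label hD, ← Labelling.label_flip]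
      by_cases hp : p ∈ evenVertex L
      · exact (h _ hp).2
      · have := (h (evenVertex L ∆ {p}) (by simp [Finset.mem_symmDiff, hp])).2
        rw [symmDiff_symmDiff_cancel_right, Labelling.label_flip] at this
        intro heq
        rw [heq, Labelling.label_flip, hD.inv_inv] at this
        exact this rfl

theorem adjNe_iff (hD : D.IsCubeGroupData) {A B : D.PointedCube p}
    {i : ({p}ᶜ : Finset (Fin k))} :
    AdjNe i A B ↔ (A.labelling hD).Adj i (B.labelling hD) := by
  have hip := coe_ne_of_compl i
  constructor
  · intro h
    have hempty : evenVertex (p := p) ∅ = ∅ := by simp [evenVertex]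
    have hsing : ∀ i : Fin k, (∅ : Finset (Fin k)) ∆ {i} = {i} := fun i => by
      rw [← Finset.bot_eq_empty, bot_symmDiff]
    -- This is the even vertex above `{i}`, where `u^{i}` starts and where the edges `w_j^{i}` and
    -- `v_i^∅` end.
    refine Labelling.adj_of_vertex hD ({p} ∆ {i.1}) (by simp [Finset.mem_symmDiff, hip]) ?_ ?_
    · intro j hj
      rw [symmDiff_symmDiff_cancel_right]
      by_cases hjp : j = p
      · subst hjp
        have := h.u_eq ∅ (Finset.notMem_empty _)
        rw [A.u_eq_label hD, B.u_eq_label hD, evenVertex_insert (Finset.notMem_empty _),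
          hempty, hsing, ← Labelling.label_flip, hsing] at this
        exact this.symm
      · obtain ⟨j, rfl⟩ : ∃ j' : ({p}ᶜ : Finset (Fin k)), j'.1 = j :=
          ⟨⟨j, by simpa using hjp⟩, rfl⟩
        have := h.v_eq ∅ j (Finset.notMem_empty _) (Finset.notMem_empty _)
          (fun h => hj (congrArg _ h))
        rw [A.w_eq_label hD, B.v_eq_label hD, evenVertex_insert (Finset.notMem_empty _),
          hempty, hsing, Labelling.label_flip] at this
        rw [← hD.inv_inv _ ((A.labelling hD).label _ _), ← this, hD.inv_inv]
    · have := h.v_ne ∅ (Finset.notMem_empty _)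
      rw [A.v_eq_label hD, B.v_eq_label hD, hempty, hsing] at this
      rw [Labelling.label_flip, symmDiff_symmDiff_cancel_right]
      intro heq
      exact this (by rw [← heq, hD.inv_inv])
  · intro h
    have hmem : ∀ L, i ∉ L → i.1 ∈ evenVertex L ∆ {p} ∆ {i.1} := by
      intro L hi
      simp [Finset.mem_symmDiff, mem_evenVertex, hi, hip]
    have hmem' : ∀ L, i ∉ L → i.1 ∈ evenVertex L ∆ {i.1} := by
      intro L hi
      simp [Finset.mem_symmDiff, mem_evenVertex, hi]
    refine ⟨fun L hi => ?_, fun L j hi hj hji => ?_, fun L j hi hj hji => ?_, fun L hi => ?_,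
      fun L hi => ?_⟩
    · rw [A.u_eq_label hD, B.u_eq_label hD, evenVertex_insert hi, (h _ (hmem L hi)).1 p hip.symm,
        symmDiff_symmDiff_cancel_right, Labelling.label_flip]
    · have hji' : j.1 ≠ i.1 := fun h => hji (Subtype.ext h)
      rw [A.w_eq_label hD, B.v_eq_label hD, evenVertex_insert hi, Labelling.label_flip,
        (h _ (hmem L hi)).1 j hji', symmDiff_symmDiff_cancel_right]
    · have hji' : j.1 ≠ i.1 := fun h => hji (Subtype.ext h)
      rw [A.v_eq_label hD, B.w_eq_label hD, evenVertex_insert hi,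
        symmDiff_right_comm (evenVertex L) {p} {i.1},
        symmDiff_symmDiff_cancel_right, (h _ (hmem' L hi)).1 j hji',
        symmDiff_symmDiff_cancel_right, Labelling.label_flip, hD.inv_inv]
    · have := (h _ (hmem L hi)).2
      rw [Labelling.label_flip, symmDiff_symmDiff_cancel_right] at this
      rw [A.v_eq_label hD, B.v_eq_label hD]
      intro heq
      rw [heq, hD.inv_inv] at this
      exact this rfl
    · rw [A.w_eq_label hD, B.w_eq_label hD, ← Labelling.label_flip]
      exact (h _ (hmem' L hi)).2

theorem adj_iff (hD : D.IsCubeGroupData) {i : Fin k} {A B : D.PointedCube p} :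
    Adj i A B ↔ (A.labelling hD).Adj i (B.labelling hD) := by
  unfold Adj
  split_ifs with h
  · subst h; exact adjP_iff hD
  · exact adjNe_iff hD

theorem existsUnique_adj_adj_swap (hD : D.IsCubeGroupData) (hk : 2 ≤ k) {i j : Fin k}
    (hij : i ≠ j) {A B X : D.PointedCube p} (hAB : Adj i A B) (hBX : Adj j B X) :
    ∃! C : D.PointedCube p, Adj j A C ∧ Adj i C X := by
  simp only [adj_iff hD] at hAB hBX ⊢
  obtain ⟨W, hW⟩ := Labelling.exists_adj_adj_swap hD hk hij hAB hBX
  obtain ⟨C, rfl⟩ := labelling_surjective (p := p) hD W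
  exact ⟨C, hW, fun C' h => labelling_injective hD
    (Labelling.eq_of_adj_adj hD hij h.1 h.2 hW.1 hW.2)⟩

theorem eq_of_adj_adj_adj (hD : D.IsCubeGroupData) {i j l : Fin k} (hij : i ≠ j) (hil : i ≠ l)
    (hjl : j ≠ l) {A B B' C C' X : D.PointedCube p} (hAB : Adj j A B) (hBC : Adj l B C)
    (hCX : Adj i C X) (hAB' : Adj l A B') (hBC' : Adj j B' C') (hCX' : Adj i C' X) : C = C' := by
  simp only [adj_iff hD] at *
  exact labelling_injective hD
    (Labelling.eq_of_adj_adj_adj hD hij hil hjl hAB hBC hCX hAB' hBC' hCX')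

theorem exists_adj (hD : D.IsCubeGroupData) (hk : 2 ≤ k) (i : Fin k) (B : D.PointedCube p) :
    ∃ A : D.PointedCube p, Adj i A B := by
  obtain ⟨X, hX⟩ := Labelling.exists_adj hD hk i (B.labelling hD)
  obtain ⟨A, rfl⟩ := labelling_surjective (p := p) hD X
  exact ⟨A, (adj_iff hD).2 hX⟩

theorem finite (hD : D.IsCubeGroupData) : Finite (D.PointedCube p) := by
  have hE : ∀ i, Finite (D.E i) := fun i => by
    obtain ⟨m, hm, h⟩ := hD.card_E i
    exact Nat.finite_of_card_ne_zero (by omega)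
  have : Function.Injective (fun (A : D.PointedCube p) i S => (A.labelling hD).label i S) := by
    intro A B h
    exact labelling_injective hD (Labelling.ext h)
  exact Finite.of_injective _ this

end PointedCube

/-! ### Morphisms of `𝒢(Γ)` -/

theorem adjMatrix_eq_one {i : Fin k} {A B : D.PointedCube p} :
    D.adjMatrix p i A B = 1 ↔ PointedCube.Adj i A B := by
  simp [adjMatrix]

/-- The edge of colour `i` from `A` to `B`. -/
def PointedCube.Adj.hom {i : Fin k} {A B : D.PointedCube p} (h : PointedCube.Adj i A B) : A ⟶ B :=
  ⟨i, adjMatrix_eq_one.2 h⟩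

theorem adj_of_hom {A B : D.PointedCube p} (e : A ⟶ B) : PointedCube.Adj e.1 A B :=
  adjMatrix_eq_one.1 e.2

/-- The morphism of `𝒢(Γ)` given by an edge. -/
def edge {A B : D.PointedCube p} (e : A ⟶ B) : D.vertex p A ⟶ D.vertex p B :=
  (Quotient.functor (D.SquareRel p)).map ((Paths.of _).map e)

theorem edge_comp_edge {A B C X : D.PointedCube p} (e : A ⟶ B) (f : B ⟶ X) (e' : A ⟶ C)
    (f' : C ⟶ X) (hne : e.1 ≠ f.1) (h₁ : e'.1 = f.1) (h₂ : f'.1 = e.1) :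
    edge e ≫ edge f = edge e' ≫ edge f' := by
  have := CategoryTheory.Quotient.sound (D.SquareRel p) (SquareRel.swap e f e' f' hne h₁ h₂)
  rwa [Functor.map_comp, Functor.map_comp] at this

theorem hom_induction {A : D.PointedCube p}
    {P : ∀ {B : D.PointedCube p}, (D.vertex p A ⟶ D.vertex p B) → Prop}
    (id : P (𝟙 (D.vertex p A)))
    (comp : ∀ {B C} (f : D.vertex p A ⟶ D.vertex p B) (e : B ⟶ C), P f → P (f ≫ edge e))
    {B : D.PointedCube p} (f : D.vertex p A ⟶ D.vertex p B) : P f := by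
  have key : ∀ {B : Paths (D.PointedCube p)} (q : (Paths.of (D.PointedCube p)).obj A ⟶ B),
      P ((Quotient.functor (D.SquareRel p)).map q) := by
    intro B q
    refine Paths.induction_fixed_source (a := (Paths.of (D.PointedCube p)).obj A)
      (fun q => P ((Quotient.functor (D.SquareRel p)).map q)) ?_ ?_ q
    · exact id
    · intro B C q e ih
      exact comp _ e ih
  obtain ⟨q, rfl⟩ := (Quotient.functor (D.SquareRel p)).map_surjective
    (X := (Paths.of (D.PointedCube p)).obj A) (Y := (Paths.of (D.PointedCube p)).obj B) f
  exact key q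

section degree

variable {Λ : Type w} [Category.{v} Λ] (d : Λ ⥤ SingleObj (Multiplicative (Fin k → ℕ)))

theorem degree_id (A : Λ) : degree d (𝟙 A) = 0 := by
  rw [degree, d.map_id]; rfl

theorem degree_comp {A B C : Λ} (f : A ⟶ B) (g : B ⟶ C) :
    degree d (f ≫ g) = degree d f + degree d g := by
  -- Composition in `SingleObj` is multiplication in the reverse order.
  rw [degree, d.map_comp, add_comm]; rfl

end degree

theorem degree_edge {A B : D.PointedCube p} (e : A ⟶ B) :
    degree (D.pathDegree p) (edge e) = Pi.single e.1 1 := by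
  have : (D.pathDegree p).map (edge e) = (D.colourDegree p).map e :=
    Category.id_comp ((D.colourDegree p).map e)
  rw [degree, this]
  rfl

/-! ### Splitting off the last edge of a colour -/

/-- A morphism from `A` to a vertex from which there is an edge of colour `i` to `B`. -/
def Ending (i : Fin k) (A B : D.PointedCube p) : Type u :=
  Σ C : {C : D.PointedCube p // PointedCube.Adj i C B}, (D.vertex p A ⟶ D.vertex p C.1)

variable {i : Fin k}

/-- Moving an edge of colour `i` past an edge `e` of another colour. -/
noncomputable def Ending.push (hD : D.IsCubeGroupData) (hk : 2 ≤ k) {A B X : D.PointedCube p}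
    (e : B ⟶ X) (he : e.1 ≠ i) (x : Ending i A B) : Ending i A X :=
  have h := (PointedCube.existsUnique_adj_adj_swap hD hk he.symm x.1.2 (adj_of_hom e)).exists
  ⟨⟨h.choose, h.choose_spec.2⟩, x.2 ≫ edge h.choose_spec.1.hom⟩

theorem Ending.exists_push_eq (hD : D.IsCubeGroupData) (hk : 2 ≤ k) {A B X : D.PointedCube p}
    (e : B ⟶ X) (he : e.1 ≠ i) (x : Ending i A B) :
    ∃ (C : D.PointedCube p) (e' : x.1.1 ⟶ C) (h : PointedCube.Adj i C X), e'.1 = e.1 ∧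
      x.push hD hk e he = ⟨⟨C, h⟩, x.2 ≫ edge e'⟩ :=
  have h := (PointedCube.existsUnique_adj_adj_swap hD hk he.symm x.1.2 (adj_of_hom e)).exists
  ⟨h.choose, h.choose_spec.1.hom, h.choose_spec.2, rfl, rfl⟩

/-- The swap is unique, so the choice made in `push` agrees with any completed square at hand. -/
theorem Ending.push_eq (hD : D.IsCubeGroupData) (hk : 2 ≤ k) {A B X C : D.PointedCube p}
    (e : B ⟶ X) (he : e.1 ≠ i) (x : Ending i A B) (e' : x.1.1 ⟶ C) (he' : e'.1 = e.1)
    (h : PointedCube.Adj i C X) :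
    x.push hD hk e he = ⟨⟨C, h⟩, x.2 ≫ edge e'⟩ := by
  obtain ⟨C', f, h', hf, heq⟩ := x.exists_push_eq hD hk e he
  rw [heq]
  have : C' = C :=
    (PointedCube.existsUnique_adj_adj_swap hD hk he.symm x.1.2 (adj_of_hom e)).unique
      ⟨hf ▸ adj_of_hom f, h'⟩ ⟨he' ▸ adj_of_hom e', h⟩
  subst this
  have : f = e' := Subtype.ext (hf.trans he'.symm)
  rw [this]

open Classical in
/-- The effect of appending the edge `e` to a morphism `s.1` with splitting `s.2` into a morphism
and a last edge of colour `i`. -/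
noncomputable def appendEdge (hD : D.IsCubeGroupData) (hk : 2 ≤ k) (i : Fin k)
    {A B X : D.PointedCube p} (e : B ⟶ X)
    (s : (D.vertex p A ⟶ D.vertex p B) × Option (Ending i A B)) :
    (D.vertex p A ⟶ D.vertex p X) × Option (Ending i A X) :=
  (s.1 ≫ edge e, if h : e.1 = i then some ⟨⟨B, h ▸ adj_of_hom e⟩, s.1⟩
    else s.2.map (Ending.push hD hk e h))

/-- Along one path the edge of colour `i` comes first and is pushed past `f`; along the other it
comes last and is split off directly. Uniqueness of swaps identifies the results. -/
theorem appendEdge_swap_of_eq (hD : D.IsCubeGroupData) (hk : 2 ≤ k) {A B C X : D.PointedCube p}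
    (e : B ⟶ C) (f : C ⟶ X) {B' : D.PointedCube p} (e' : B ⟶ B') (f' : B' ⟶ X) (hne : e.1 ≠ f.1)
    (h₁ : e'.1 = f.1) (h₂ : f'.1 = e.1)
    (he : e.1 = i) (s : (D.vertex p A ⟶ D.vertex p B) × Option (Ending i A B)) :
    appendEdge hD hk i f (appendEdge hD hk i e s) =
      appendEdge hD hk i f' (appendEdge hD hk i e' s) := by
  have hf : f.1 ≠ i := he ▸ hne.symm
  have hf' : f'.1 = i := h₂.trans he
  refine Prod.ext ?_ ?_
  · simp only [appendEdge, Category.assoc, edge_comp_edge e f e' f' hne h₁ h₂]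
  · simp only [appendEdge, dif_pos he, dif_neg hf, dif_pos hf']
    exact congrArg some (Ending.push_eq hD hk f hf ⟨⟨B, he ▸ adj_of_hom e⟩, s.1⟩ e' h₁
      (hf' ▸ adj_of_hom f'))

/-- Splittings respect the congruence. If neither colour is `i`, an earlier edge of colour `i` is
pushed past both edges in either order; the three-colour condition gives the same vertex, and the
paths to it differ by a square. -/
theorem appendEdge_swap (hD : D.IsCubeGroupData) (hk : 2 ≤ k) {A B C X : D.PointedCube p}
    (e : B ⟶ C) (f : C ⟶ X) {B' : D.PointedCube p} (e' : B ⟶ B') (f' : B' ⟶ X) (hne : e.1 ≠ f.1)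
    (h₁ : e'.1 = f.1) (h₂ : f'.1 = e.1)
    (s : (D.vertex p A ⟶ D.vertex p B) × Option (Ending i A B)) :
    appendEdge hD hk i f (appendEdge hD hk i e s) =
      appendEdge hD hk i f' (appendEdge hD hk i e' s) := by
  by_cases he : e.1 = i
  · exact appendEdge_swap_of_eq hD hk e f e' f' hne h₁ h₂ he s
  by_cases hf : f.1 = i
  · exact (appendEdge_swap_of_eq hD hk e' f' e f (by rw [h₁, h₂]; exact hne.symm) h₂.symm h₁.symm
      (h₁.trans hf) s).symm
  have he' : e'.1 ≠ i := h₁ ▸ hf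
  have hf' : f'.1 ≠ i := h₂ ▸ he
  refine Prod.ext ?_ ?_
  · simp only [appendEdge, Category.assoc, edge_comp_edge e f e' f' hne h₁ h₂]
  simp only [appendEdge, dif_neg he, dif_neg hf, dif_neg he', dif_neg hf', Option.map_map]
  congr 1
  funext x
  simp only [Function.comp_apply]
  obtain ⟨C₁, e₁, a₁, b₁, c₁⟩ := x.exists_push_eq hD hk e he
  rw [c₁]
  obtain ⟨C₂, e₂, a₂, b₂, c₂⟩ := Ending.exists_push_eq hD hk f hf
    (⟨⟨C₁, a₁⟩, x.2 ≫ edge e₁⟩ : Ending i A C)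
  rw [c₂]
  obtain ⟨C₃, e₃, a₃, b₃, c₃⟩ := x.exists_push_eq hD hk e' he'
  rw [c₃]
  obtain ⟨C₄, e₄, a₄, b₄, c₄⟩ := Ending.exists_push_eq hD hk f' hf'
    (⟨⟨C₃, a₃⟩, x.2 ≫ edge e₃⟩ : Ending i A B')
  rw [c₄]
  dsimp only at e₂ e₄
  have hC : C₂ = C₄ := PointedCube.eq_of_adj_adj_adj hD (Ne.symm he) (Ne.symm hf) hne
    (b₁ ▸ adj_of_hom e₁) (b₂ ▸ adj_of_hom e₂) a₂ ((b₃.trans h₁) ▸ adj_of_hom e₃)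
    ((b₄.trans h₂) ▸ adj_of_hom e₄) a₄
  subst hC
  simp only [Category.assoc]
  rw [edge_comp_edge e₁ e₂ e₃ e₄ (by rw [b₁, b₂]; exact hne) (by rw [b₃, b₂, h₁])
    (by rw [b₄, b₁, h₂])]

/-- The functor that sends `B` to the set of morphisms `A ⟶ B` with a splitting. -/
noncomputable def splitting (hD : D.IsCubeGroupData) (hk : 2 ≤ k) (i : Fin k)
    (A : D.PointedCube p) : D.PathCategory p ⥤ Type u :=
  CategoryTheory.Quotient.lift _ (Paths.lift
    -- The whole morphism is carried along because it becomes the remainder once an edge of colour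
    -- `i` is appended.
    { obj := fun B => (D.vertex p A ⟶ D.vertex p B) × Option (Ending i A B)
      map := fun e => ↾(appendEdge hD hk i e) }) (by
    rintro _ _ _ _ ⟨e, f, e', f', hne, h₁, h₂⟩
    ext s
    exact appendEdge_swap hD hk e f e' f' hne h₁ h₂ s)

/-- A morphism together with the splitting off of its last edge of colour `i`, if there is one. -/
noncomputable def splitLast (hD : D.IsCubeGroupData) (hk : 2 ≤ k) (i : Fin k)
    {A B : D.PointedCube p} (f : D.vertex p A ⟶ D.vertex p B) :
    (D.vertex p A ⟶ D.vertex p B) × Option (Ending i A B) :=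
  (splitting hD hk i A).map f (𝟙 (D.vertex p A), none)

theorem splitLast_comp_edge (hD : D.IsCubeGroupData) (hk : 2 ≤ k) {A B C : D.PointedCube p}
    (f : D.vertex p A ⟶ D.vertex p B) (e : B ⟶ C) :
    splitLast hD hk i (f ≫ edge e) = appendEdge hD hk i e (splitLast hD hk i f) :=
  congrArg (fun g : (splitting hD hk i A).obj (D.vertex p A) ⟶
      (splitting hD hk i A).obj (D.vertex p C) => g (𝟙 (D.vertex p A), none))
    ((splitting hD hk i A).map_comp f (edge e))

theorem splitLast_fst (hD : D.IsCubeGroupData) (hk : 2 ≤ k) {A B : D.PointedCube p}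
    (f : D.vertex p A ⟶ D.vertex p B) : (splitLast hD hk i f).1 = f := by
  induction f using hom_induction with
  | id => rfl
  | comp f e ih =>
    rw [splitLast_comp_edge]
    exact congrArg (· ≫ edge e) ih

/-- The last edge of a given colour of a morphism is unique. -/
theorem comp_edge_cancel (hD : D.IsCubeGroupData) (hk : 2 ≤ k) {A B C C' : D.PointedCube p}
    {q : D.vertex p A ⟶ D.vertex p C} {q' : D.vertex p A ⟶ D.vertex p C'} {e : C ⟶ B}
    {e' : C' ⟶ B} (he : e.1 = e'.1) (h : q ≫ edge e = q' ≫ edge e') :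
    (⟨C, q, e⟩ : Σ C : D.PointedCube p, (D.vertex p A ⟶ D.vertex p C) × (C ⟶ B)) =
      ⟨C', q', e'⟩ := by
  -- The splitting depends only on the composite morphism, yet it returns the pair `C`, `q`.
  have key : ∀ {C : D.PointedCube p} (q : D.vertex p A ⟶ D.vertex p C) (e : C ⟶ B)
      (h : e.1 = e'.1), (splitLast hD hk e'.1 (q ≫ edge e)).2 =
        some ⟨⟨C, h ▸ adj_of_hom e⟩, q⟩ := by
    intro C q e h
    rw [splitLast_comp_edge]
    simp only [appendEdge, dif_pos h, splitLast_fst]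
  have h1 := key q e he
  rw [h, key q' e' rfl] at h1
  replace h1 := Option.some.inj h1
  have hC : C' = C := congrArg (fun x => x.1.1) h1
  subst hC
  have : e = e' := Subtype.ext he
  subst this
  have : q' = q := eq_of_heq (Sigma.mk.inj h1).2
  rw [this]

/-- A morphism with an edge of colour `i` can be written with such an edge at its end. -/
theorem exists_comp_edge (hD : D.IsCubeGroupData) (hk : 2 ≤ k) {A B : D.PointedCube p}
    (f : D.vertex p A ⟶ D.vertex p B) (hf : degree (D.pathDegree p) f i ≠ 0) :
    ∃ (C : D.PointedCube p) (q : D.vertex p A ⟶ D.vertex p C) (e : C ⟶ B), e.1 = i ∧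
      q ≫ edge e = f := by
  induction f using hom_induction with
  | id => simp [degree_id] at hf
  | @comp B X f e ih =>
    by_cases he : e.1 = i
    · exact ⟨B, f, e, he, rfl⟩
    · rw [degree_comp, degree_edge] at hf
      obtain ⟨C, q, g, hg, rfl⟩ := ih (by simpa [Pi.single_apply, Ne.symm he] using hf)
      obtain ⟨C', ⟨h1, h2⟩, -⟩ := PointedCube.existsUnique_adj_adj_swap hD hk
        (hg.trans_ne (Ne.symm he)) (adj_of_hom g) (adj_of_hom e)
      refine ⟨C', q ≫ edge h1.hom, h2.hom, hg, ?_⟩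
      rw [Category.assoc, Category.assoc,
        edge_comp_edge g e h1.hom h2.hom (hg.trans_ne (Ne.symm he)) rfl rfl]

theorem eq_id_of_degree_eq_zero {A B : D.PointedCube p} (f : D.vertex p A ⟶ D.vertex p B)
    (hf : degree (D.pathDegree p) f = 0) :
    ∃ h : A = B, f = eqToHom (congrArg (D.vertex p) h) := by
  induction f using hom_induction with
  | id => exact ⟨rfl, rfl⟩
  | comp f e ih =>
    rw [degree_comp, degree_edge] at hf
    have := congrFun hf e.1
    simp at this

/-! ### Factorizations, by induction on the total degree -/

theorem exists_eq_add_single {n : Fin k → ℕ} {N : ℕ} (hN : ∑ i, n i = N + 1) :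
    ∃ (i : Fin k) (n' : Fin k → ℕ), n = n' + Pi.single i 1 ∧ ∑ i, n' i = N := by
  obtain ⟨i, hi⟩ : ∃ i, n i ≠ 0 := by
    by_contra! h; simp [h] at hN
  have h : n = n - Pi.single i 1 + Pi.single i 1 := (tsub_add_cancel_of_le (by
    intro j
    by_cases h : j = i
    · subst h; simpa using Nat.one_le_iff_ne_zero.2 hi
    · simp [h])).symm
  refine ⟨i, _, h, ?_⟩
  rw [h] at hN
  simp only [Pi.add_apply, Finset.sum_add_distrib, Finset.sum_pi_single', Finset.mem_univ,
    if_true] at hN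
  omega

theorem exists_factorization (hD : D.IsCubeGroupData) (hk : 2 ≤ k) (N : ℕ)
    {A B : D.PointedCube p} (f : D.vertex p A ⟶ D.vertex p B) (m n : Fin k → ℕ)
    (hN : ∑ i, n i = N) (hf : degree (D.pathDegree p) f = m + n) :
    ∃ (C : D.PointedCube p) (a : D.vertex p A ⟶ D.vertex p C) (b : D.vertex p C ⟶ D.vertex p B),
      a ≫ b = f ∧ degree (D.pathDegree p) a = m ∧ degree (D.pathDegree p) b = n := by
  induction N generalizing B n with
  | zero =>
    have hn : n = 0 := by
      funext i; simpa using (Finset.sum_eq_zero_iff.1 hN) i (Finset.mem_univ i)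
    exact ⟨B, f, 𝟙 _, Category.comp_id _, by simpa [hn] using hf, by rw [degree_id, hn]⟩
  | succ N ih =>
    obtain ⟨i, n, rfl, hn⟩ := exists_eq_add_single hN
    obtain ⟨C, q, e, rfl, rfl⟩ := exists_comp_edge hD hk (i := i) f (by simp [hf])
    have hq : degree (D.pathDegree p) q = m + n := by
      rw [degree_comp, degree_edge, ← add_assoc] at hf
      exact add_right_cancel hf
    obtain ⟨C', a, b, rfl, rfl, rfl⟩ := ih q n hn hq
    exact ⟨C', a, b ≫ edge e, (Category.assoc _ _ _).symm, rfl, by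
      rw [degree_comp, degree_edge]⟩

/-- As `b` and `b'` have the same degree, an edge of the same colour can be moved to the end of
both; `comp_edge_cancel` removes it. -/
theorem factorization_unique (hD : D.IsCubeGroupData) (hk : 2 ≤ k) (N : ℕ)
    {A B C C' : D.PointedCube p} (a : D.vertex p A ⟶ D.vertex p C)
    (b : D.vertex p C ⟶ D.vertex p B) (a' : D.vertex p A ⟶ D.vertex p C')
    (b' : D.vertex p C' ⟶ D.vertex p B) (h : a ≫ b = a' ≫ b')
    (hb : degree (D.pathDegree p) b = degree (D.pathDegree p) b')
    (hN : ∑ i, degree (D.pathDegree p) b i = N) :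
    (⟨C, a, b⟩ : Σ C : D.PointedCube p,
      (D.vertex p A ⟶ D.vertex p C) × (D.vertex p C ⟶ D.vertex p B)) = ⟨C', a', b'⟩ := by
  induction N generalizing B with
  | zero =>
    have hn : degree (D.pathDegree p) b = 0 := by
      funext i; simpa using (Finset.sum_eq_zero_iff.1 hN) i (Finset.mem_univ i)
    obtain ⟨rfl, rfl⟩ := eq_id_of_degree_eq_zero b hn
    obtain ⟨rfl, rfl⟩ := eq_id_of_degree_eq_zero b' (hb ▸ hn)
    simp only [eqToHom_refl, Category.comp_id] at h
    rw [h]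
  | succ N ih =>
    obtain ⟨i, hi⟩ : ∃ i, degree (D.pathDegree p) b i ≠ 0 := by
      by_contra! h; simp [h] at hN
    obtain ⟨X, b, e, he, rfl⟩ := exists_comp_edge hD hk b hi
    obtain ⟨X', b', e', he', rfl⟩ := exists_comp_edge hD hk b' (hb ▸ hi)
    rw [← Category.assoc, ← Category.assoc] at h
    have := comp_edge_cancel hD hk (he.trans he'.symm) h
    obtain rfl : X = X' := congrArg Sigma.fst this
    simp only [Sigma.mk.injEq, heq_eq_eq, true_and, Prod.mk.injEq] at this
    obtain ⟨hab, rfl⟩ := this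
    rw [degree_comp, degree_comp] at hb
    have := ih b b' hab (add_right_cancel hb) (by
      simp only [degree_comp, degree_edge, Pi.add_apply, Finset.sum_add_distrib,
        Finset.sum_pi_single', Finset.mem_univ, if_true] at hN
      omega)
    obtain rfl : C = C' := congrArg Sigma.fst this
    simp only [Sigma.mk.injEq, heq_eq_eq, true_and, Prod.mk.injEq] at this
    obtain ⟨rfl, rfl⟩ := this
    rfl

/-! ### Finiteness, sources and the `1`-skeleton -/

theorem isRowFinite (hD : D.IsCubeGroupData) (hk : 2 ≤ k) : IsRowFinite (D.pathDegree p) := by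
  have := PointedCube.finite (p := p) hD
  have key : ∀ (N : ℕ) (n : Fin k → ℕ), ∑ i, n i = N → ∀ B : D.PointedCube p,
      (morphismsInto (D.pathDegree p) n (D.vertex p B)).Finite := by
    intro N
    induction N with
    | zero =>
      intro n hN B
      refine (Set.finite_singleton ⟨D.vertex p B, 𝟙 _⟩).subset ?_
      rintro ⟨⟨A⟩, f⟩ hf
      have hn : n = 0 := by
        funext i; simpa using (Finset.sum_eq_zero_iff.1 hN) i (Finset.mem_univ i)
      obtain ⟨rfl, h⟩ := eq_id_of_degree_eq_zero (A := A) (B := B) f (hf.trans hn)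
      exact congrArg (fun g => (⟨_, g⟩ : Σ X, X ⟶ D.vertex p A)) h
    | succ N ih =>
      intro n hN B
      obtain ⟨i, n, rfl, hn⟩ := exists_eq_add_single hN
      have : ∀ A B : D.PointedCube p, Finite (A ⟶ B) := fun A B =>
        inferInstanceAs (Finite {i : Fin k // D.adjMatrix p i A B = 1})
      -- A morphism of degree `n + e_i` into `B` ends in one of the finitely many edges into `B`,
      -- preceded by a morphism of degree `n`.
      refine (Set.finite_iUnion fun x : Σ C : D.PointedCube p, C ⟶ B =>
        (ih n hn x.1).image
          fun g => (⟨g.1, g.2 ≫ edge x.2⟩ : Σ A, A ⟶ D.vertex p B)).subset ?_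
      rintro ⟨⟨A : D.PointedCube p⟩, f : D.vertex p A ⟶ D.vertex p B⟩ hf
      change degree (D.pathDegree p) f = n + Pi.single i 1 at hf
      obtain ⟨C, q, e, he, rfl⟩ := exists_comp_edge hD hk (i := i) f (by simp [hf])
      refine Set.mem_iUnion.2 ⟨⟨C, e⟩, ⟨D.vertex p A, q⟩, ?_, rfl⟩
      change degree (D.pathDegree p) q = n
      rw [degree_comp, degree_edge, he] at hf
      exact add_right_cancel hf
  exact fun n v => key _ n rfl v.as

theorem hasNoSources (hD : D.IsCubeGroupData) (hk : 2 ≤ k) : HasNoSources (D.pathDegree p) := by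
  have key : ∀ (N : ℕ) (n : Fin k → ℕ), ∑ i, n i = N → ∀ B : D.PointedCube p,
      (morphismsInto (D.pathDegree p) n (D.vertex p B)).Nonempty := by
    intro N
    induction N with
    | zero =>
      intro n hN B
      have hn : n = 0 := by
        funext i; simpa using (Finset.sum_eq_zero_iff.1 hN) i (Finset.mem_univ i)
      exact ⟨⟨_, 𝟙 _⟩, (degree_id _ _).trans hn.symm⟩
    | succ N ih =>
      intro n hN B
      obtain ⟨i, n, rfl, hn⟩ := exists_eq_add_single hN
      obtain ⟨C, hC⟩ := PointedCube.exists_adj hD hk i B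
      obtain ⟨⟨A, f⟩, hf⟩ := ih n hn C
      refine ⟨⟨A, f ≫ edge hC.hom⟩, ?_⟩
      change degree _ _ = _ at hf ⊢
      rw [degree_comp, hf, degree_edge]
      rfl
  exact fun n v => key _ n rfl v.as

theorem isKRankGraph (hD : D.IsCubeGroupData) (hk : 2 ≤ k) : IsKRankGraph (D.pathDegree p) where
  countable_obj := by
    have := PointedCube.finite (p := p) hD
    exact (Quotient.equiv (D.SquareRel p)).injective.countable (β := D.PointedCube p)
  countable_hom := by
    have := PointedCube.finite (p := p) hD
    have hobj : Countable (D.PathCategory p) :=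
      (Quotient.equiv (D.SquareRel p)).injective.countable (β := D.PointedCube p)
    have hinto : ∀ B : D.PathCategory p, Countable (Σ A : D.PathCategory p, A ⟶ B) := by
      intro B
      -- The morphisms into `B` are the union over the countably many degrees of finite sets.
      refine Set.countable_univ_iff.1 ((Set.countable_iUnion fun n : Fin k → ℕ =>
        (isRowFinite hD hk n B).countable).mono fun f _ =>
          Set.mem_iUnion.2 ⟨degree (D.pathDegree p) f.2,
            show f ∈ morphismsInto (D.pathDegree p) _ B from rfl⟩)
    exact Function.Injective.countable (β := Σ B : D.PathCategory p, Σ A : D.PathCategory p, A ⟶ B)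
      (f := fun x => ⟨x.2.1, x.1, x.2.2⟩) (by rintro ⟨A, B, f⟩ ⟨A', B', f'⟩ h; cases h; rfl)
  factorization := by
    rintro ⟨A⟩ ⟨B⟩ f m n hf
    obtain ⟨C, a, b, rfl, rfl, rfl⟩ := exists_factorization hD hk _ (A := A) (B := B) f m n rfl hf
    refine ⟨⟨D.vertex p C, a, b⟩, ⟨rfl, rfl, rfl⟩, ?_⟩
    rintro ⟨⟨C'⟩, a', b'⟩ ⟨h, -, hb⟩
    exact congrArg (fun x : Σ C : D.PointedCube p, (D.vertex p A ⟶ D.vertex p C) ×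
      (D.vertex p C ⟶ D.vertex p B) => (⟨D.vertex p x.1, x.2.1, x.2.2⟩ :
        Σ C : D.PathCategory p, (D.vertex p A ⟶ C) × (C ⟶ D.vertex p B)))
      (factorization_unique hD hk _ (C := C') a' b' a b h hb rfl)

theorem bijOn_morphismsOfDegree_zero :
    Set.BijOn (fun A : D.PointedCube p =>
        (⟨D.vertex p A, D.vertex p A, 𝟙 (D.vertex p A)⟩ : Σ A B : D.PathCategory p, A ⟶ B))
      Set.univ (morphismsOfDegree (D.pathDegree p) 0) := by
  refine ⟨fun A _ => degree_id _ _, fun A _ B _ h => ?_, ?_⟩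
  · exact congrArg (fun x : Σ A B : D.PathCategory p, A ⟶ B => x.1.as) h
  · rintro ⟨⟨A⟩, ⟨B⟩, f⟩ hf
    obtain ⟨rfl, h⟩ := eq_id_of_degree_eq_zero (A := A) (B := B) f hf
    refine ⟨A, trivial, ?_⟩
    exact congrArg (fun g => (⟨D.vertex p A, D.vertex p A, g⟩ : Σ A B : D.PathCategory p, A ⟶ B))
      h.symm

theorem exists_edge_eq (hD : D.IsCubeGroupData) (hk : 2 ≤ k) {A B : D.PointedCube p}
    (f : D.vertex p A ⟶ D.vertex p B) (hf : degree (D.pathDegree p) f = Pi.single i 1) :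
    ∃ e : A ⟶ B, e.1 = i ∧ edge e = f := by
  obtain ⟨C, q, e, he, rfl⟩ := exists_comp_edge hD hk (i := i) f (by simp [hf])
  rw [degree_comp, degree_edge, he, add_eq_right] at hf
  obtain ⟨rfl, rfl⟩ := eq_id_of_degree_eq_zero q hf
  exact ⟨e, he, by simp⟩

/-- A morphism of degree `e_i` is a single edge, and an edge is determined by its end points and
colour. -/
theorem card_degree_single (hD : D.IsCubeGroupData) (hk : 2 ≤ k) (i : Fin k)
    (A B : D.PointedCube p) :
    Nat.card {f : D.vertex p A ⟶ D.vertex p B //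
      degree (D.pathDegree p) f = Pi.single i 1} = D.adjMatrix p i A B := by
  by_cases h : PointedCube.Adj i A B
  · rw [adjMatrix_eq_one.2 h, Nat.card_eq_one_iff_unique]
    refine ⟨⟨?_⟩, ⟨⟨edge h.hom, degree_edge _⟩⟩⟩
    rintro ⟨f, hf⟩ ⟨g, hg⟩
    obtain ⟨e, he, rfl⟩ := exists_edge_eq hD hk f hf
    obtain ⟨e', he', rfl⟩ := exists_edge_eq hD hk g hg
    obtain rfl : e = e' := Subtype.ext (he.trans he'.symm)
    rfl
  · rw [adjMatrix, if_neg h, Nat.card_eq_zero]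
    refine Or.inl ⟨?_⟩
    rintro ⟨f, hf⟩
    obtain ⟨e, rfl, -⟩ := exists_edge_eq hD hk f hf
    exact h (adj_of_hom e)

end SquareData

theorem mainTheorem1 {k : ℕ} (hk : 2 ≤ k) {Γ : Type v} [Group Γ]
    (G : CubeGroupStructure.{u, v} k Γ) (p : Fin k) :
    IsKRankGraph (G.data.pathDegree p) ∧
    IsRowFinite (G.data.pathDegree p) ∧
    HasNoSources (G.data.pathDegree p) ∧
    Set.BijOn (fun A : G.data.PointedCube p =>
        (⟨G.data.vertex p A, G.data.vertex p A, 𝟙 (G.data.vertex p A)⟩ :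
          Σ A B : G.data.PathCategory p, A ⟶ B))
      Set.univ (morphismsOfDegree (G.data.pathDegree p) 0) ∧
    ∀ (i : Fin k) (A B : G.data.PointedCube p),
      Nat.card {f : G.data.vertex p A ⟶ G.data.vertex p B //
        degree (G.data.pathDegree p) f = Pi.single i 1} = G.data.adjMatrix p i A B :=
  have hD := G.isCubeGroupData
  ⟨SquareData.isKRankGraph hD hk, SquareData.isRowFinite hD hk, SquareData.hasNoSources hD hk,
    SquareData.bijOn_morphismsOfDegree_zero, SquareData.card_degree_single hD hk⟩
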